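/- Let $\Omega$ be a finite simple graph with at least one vertex. A matching is a set of pairwise disjoint edges, and $\nu(\Omega)$ denotes the largest number of edges in a matching of $\Omega$. For a vertex $i$ let $N(i)$ be the set of vertices adjacent to $i$, let $\deg(i)=|N(i)|$, and let $\Omega-N(i)$ be the induced subgraph obtained by deleting the vertices of $N(i)$ (the vertex $i$ itself is kept). Call $\Omega$ *4-saturating* if $\nu(\Omega)<4$ and $\nu(\Omega-N(i))\ge 4-\deg(i)$ for every vertex $i$. Say that $\Omega$ is *spanned by* a graph $H$ if $\Omega$ has a (not necessarily induced) subgraph isomorphic to $H$ that contains all vertices of $\Omega$. In a disjoint union there are no edges between the different parts. **Theorem.** $\Omega$ is 4-saturating if and only if it is of at least one of the following 13 types: 1. $\Omega$ is a complete graph $K_5$; 2. $\Omega$ is spanned by a cone on the cycle $C_5$ (six vertices); 3. $\Omega$ is spanned by the union of the four triangles $\{i,p,q\}$, $\{i,u,v\}$, $\{j,p,q\}$, $\{j,u,v\}$ on six distinct vertices $i,j,p,q,u,v$; 4. $\Omega$ is spanned by a triangular prism (two disjoint triangles joined by three pairwise disjoint edges); 5. $\Omega$ is a disjoint union of a triangle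 and a graph spanned by $C_5$; 6. $\Omega$ is a disjoint union of a triangle and a graph spanned by two triangles with exactly one vertex in common; 7. $\Omega$ is a disjoint union of a triangle and a $K_4$; 8. $\Omega$ is spanned by $C_7$; 9. $\Omega$ is spanned by a union of a triangle and a pentagon with exactly one vertex in common; 10. $\Omega$ is spanned by a union of two pentagons whose intersection is a path of length 2 (seven vertices); 11. $\Omega$ is spanned by a union of three triangles sharing one common vertex and otherwise disjoint (seven vertices); 12. $\Omega$ is spanned by two disjoint triangles connected by a path of length 2 (from a vertex of one triangle through a seventh vertex to a vertex of the other); 13. $\Omega$ is a disjoint union of three triangles. -/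

import Mathlib

namespace EdgeIdealGraphs

/-- The matching number `ν(G)`: the largest number of edges of a matching of `G`
(used for finite graphs, where the set below is bounded). -/
noncomputable def matchingNumber {V : Type*} (G : SimpleGraph V) : ℕ :=
  sSup {k : ℕ | ∃ M : G.Subgraph, M.IsMatching ∧ M.edgeSet.ncard = k}

/-- For a finite graph the set defining the matching number is bounded. -/
theorem matchingNumber_bddAbove {V : Type*} [Finite V] (G : SimpleGraph V) :
    BddAbove {k : ℕ | ∃ M : G.Subgraph, M.IsMatching ∧ M.edgeSet.ncard = k} := by
  refine ⟨(Set.univ : Set (Sym2 V)).ncard, ?_⟩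
  rintro k ⟨M, -, rfl⟩
  exact Set.ncard_le_ncard (Set.subset_univ _) (Set.toFinite _)

/-- A finite simple graph `G` is `t`-saturating if `ν(G) < t` and
`ν(G - N(i)) ≥ t - deg(i)` for every vertex `i` (the inequality is written without
subtraction). Here `G - N(i)` is the subgraph induced on the complement of the open
neighbourhood `N(i)`; in particular it contains `i`. -/
def IsSaturating {V : Type*} [Fintype V] (G : SimpleGraph V) [DecidableRel G.Adj]
    (t : ℕ) : Prop :=
  matchingNumber G < t ∧
    ∀ i : V, t ≤ matchingNumber (G.induce (G.neighborSet i)ᶜ) + G.degree i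

/-- `G` is spanned by `H`: there is a subgraph of `G`, containing all vertices of `G`, that is
isomorphic to `H`. -/
def IsSpannedBy {V W : Type*} (G : SimpleGraph V) (H : SimpleGraph W) : Prop :=
  ∃ f : H →g G, Function.Bijective f

/-- The graph on `n` vertices with a prescribed finite list of edges. -/
def ofEdges {n : ℕ} (E : Finset (Sym2 (Fin n))) : SimpleGraph (Fin n) :=
  SimpleGraph.fromEdgeSet (E : Set (Sym2 (Fin n)))

/-- The complete graph `K_n`. -/
abbrev K (n : ℕ) : SimpleGraph (Fin n) := ⊤

/-- The cone on the pentagon `0 1 2 3 4`, with apex `5`. -/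
def coneOnPentagon : SimpleGraph (Fin 6) :=
  ofEdges {s(0, 1), s(1, 2), s(2, 3), s(3, 4), s(4, 0),
    s(5, 0), s(5, 1), s(5, 2), s(5, 3), s(5, 4)}

/-- The union of the four triangles `0 2 3`, `0 4 5`, `1 2 3`, `1 4 5`. -/
def fourTriangles : SimpleGraph (Fin 6) :=
  ofEdges {s(2, 3), s(4, 5),
    s(0, 2), s(0, 3), s(0, 4), s(0, 5),
    s(1, 2), s(1, 3), s(1, 4), s(1, 5)}

/-- The triangular prism: triangles `0 1 2` and `3 4 5` joined by three disjoint edges. -/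
def triangularPrism : SimpleGraph (Fin 6) :=
  ofEdges {s(0, 1), s(1, 2), s(0, 2), s(3, 4), s(4, 5), s(3, 5),
    s(0, 3), s(1, 4), s(2, 5)}

/-- The bowtie: two triangles `0 1 2` and `0 3 4` meeting at the vertex `0`. -/
def bowtie : SimpleGraph (Fin 5) :=
  ofEdges {s(0, 1), s(0, 2), s(1, 2), s(0, 3), s(0, 4), s(3, 4)}

/-- The triangle `0 1 2` and the pentagon `0 3 4 5 6` meeting at the vertex `0`. -/
def trianglePentagon : SimpleGraph (Fin 7) :=
  ofEdges {s(0, 1), s(1, 2), s(0, 2),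
    s(0, 3), s(3, 4), s(4, 5), s(5, 6), s(6, 0)}

/-- The pentagons `0 1 2 3 4` and `0 1 2 5 6`, sharing the path `0 1 2` of length `2`. -/
def twoPentagons : SimpleGraph (Fin 7) :=
  ofEdges {s(0, 1), s(1, 2), s(2, 3), s(3, 4), s(4, 0), s(2, 5), s(5, 6), s(6, 0)}

/-- The triangles `0 1 2`, `0 3 4` and `0 5 6` meeting at the vertex `0`. -/
def threeTriangles : SimpleGraph (Fin 7) :=
  ofEdges {s(0, 1), s(0, 2), s(1, 2), s(0, 3), s(0, 4), s(3, 4), s(0, 5), s(0, 6), s(5, 6)}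

/-- The disjoint triangles `0 1 2` and `4 5 6`, connected by the path `2 3 4` of length `2`. -/
def trianglesWithPath : SimpleGraph (Fin 7) :=
  ofEdges {s(0, 1), s(0, 2), s(1, 2), s(2, 3), s(3, 4), s(4, 5), s(4, 6), s(5, 6)}

end EdgeIdealGraphs

open EdgeIdealGraphs SimpleGraph

/-! The condition at a vertex i is equivalent to a configuration: a set L of neighbours of i
together with a matching avoiding i and L, having at least four members in total. Enlarging L to
N(i) costs at most one matching edge per added vertex (`IsSaturating.iff_matchInv`). Configurations
survive the addition of edges, so for the types given by a spanning graph it suffices to inspect the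
template, a finite check. The bound ν < 4 is automatic below eight vertices; the types of order
eight and nine contain two disjoint odd sets without outgoing edges, and each of these leaves a
vertex unmatched.

Conversely, a configuration needs at least five vertices, and on five vertices it forces all edges
at i, hence K_5. On six vertices, counting shows that the complement is triangle-free of maximum
degree at most two (`adj_of_hasConfig`), and a case analysis finds the cone, the four triangles or
the prism (`isSixType_of_card_six`).

Larger orders rest on Tutte's theorem. A barrier is a set A with a family P of disjoint odd blocks
whose neighbours outside the block lie in A. If ν < 4 and |V| ≥ 8, some barrier has |P| ≥ |A| + |V|
- 6 (`exists_isBarrier_of_eight_le`). Comparing with a configuration inside a block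
(`HasConfig.card_neighbors_ge`) shows that every block has minimum inner degree two, hence at least
three vertices, so that |A| + |P| ≤ 3. For order at least nine this leaves three triangles. For
order eight, A is empty and one block is a triangle component; the other five vertices satisfy the
same density conditions as in order six.

On seven vertices, either the graph is factor-critical, and an odd ear decomposition produces the
five connected types (`IsFactorCritical.isSevenType`), or there is a barrier through some vertex v.
The latter must consist of v and two triangles, and it yields two triangles joined by a path, or K_3
plus K_4. -/

namespace EdgeIdealGraphs

/-! ### Matchings as involutions -/

/-- An involution of the vertices that moves every vertex it does not fix along an edge.
Such maps encode matchings. -/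
def IsMatchInv {V : Type*} (G : SimpleGraph V) (f : V → V) : Prop :=
  (∀ x, f (f x) = x) ∧ ∀ x, f x ≠ x → G.Adj x (f x)

open Classical in
/-- The points moved by a map. -/
noncomputable def moved {V : Type*} [Fintype V] (f : V → V) : Finset V :=
  Finset.univ.filter fun x => f x ≠ x

@[simp] lemma mem_moved {V : Type*} [Fintype V] {f : V → V} {x : V} :
    x ∈ moved f ↔ f x ≠ x := by
  simp [moved]

/-- Over `ZMod 2` the sum of ones over `s` cancels in pairs. -/
lemma even_card_of_invol {V : Type*} (s : Finset V) (f : V → V)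
    (hs : ∀ x ∈ s, f x ∈ s) (hf : ∀ x ∈ s, f (f x) = x) (hne : ∀ x ∈ s, f x ≠ x) :
    Even s.card := by
  have h : ∑ _x ∈ s, (1 : ZMod 2) = 0 :=
    Finset.sum_involution (fun x _ => f x) (fun _ _ => by decide)
      (fun x hx _ => hne x hx) (fun x hx => hs x hx) (fun x hx => hf x hx)
  rw [Finset.sum_const, nsmul_eq_mul, mul_one] at h
  exact (ZMod.natCast_eq_zero_iff_even).1 h

lemma exists_fixed_of_odd {V : Type*} (s : Finset V) (f : V → V)
    (hs : ∀ x ∈ s, f x ∈ s) (hf : ∀ x ∈ s, f (f x) = x) (hodd : Odd s.card) :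
    ∃ x ∈ s, f x = x := by
  by_contra! h
  exact (Nat.not_even_iff_odd.2 hodd) (even_card_of_invol s f hs hf h)

/-- The graph whose edges are the two-element orbits of `f`. -/
def orbitGraph {V : Type*} (f : V → V) (hf : ∀ x, f (f x) = x) : SimpleGraph V where
  Adj x y := x ≠ y ∧ f x = y
  symm := ⟨by rintro x y ⟨h, rfl⟩; exact ⟨h.symm, hf x⟩⟩
  loopless := ⟨fun x h => h.1 rfl⟩

/-- Handshake lemma: in the orbit graph a moved vertex has degree one and a fixed vertex degree
zero. -/
lemma two_mul_ncard_orbitGraph {V : Type*} [Fintype V] (f : V → V) (hf : ∀ x, f (f x) = x) :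
    2 * (orbitGraph f hf).edgeSet.ncard = (moved f).card := by
  classical
  have h := (orbitGraph f hf).sum_degrees_eq_twice_card_edges
  rw [← SimpleGraph.coe_edgeFinset, Set.ncard_coe_finset, ← h, moved, Finset.card_filter]
  refine Finset.sum_congr rfl fun x _ => ?_
  rw [← SimpleGraph.card_neighborFinset_eq_degree]
  split_ifs with hx
  · rw [Finset.card_eq_one]
    refine ⟨f x, Finset.ext fun y => ?_⟩
    rw [SimpleGraph.mem_neighborFinset, Finset.mem_singleton]
    exact ⟨fun h => h.2.symm, fun h => ⟨fun h' => hx (h.symm.trans h'.symm), h.symm⟩⟩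
  · rw [Finset.card_eq_zero]
    refine Finset.eq_empty_of_forall_notMem fun y hy => ?_
    rw [SimpleGraph.mem_neighborFinset] at hy
    exact hx fun h => hy.1 (h.symm.trans hy.2)

lemma exists_matchInv_of_isMatching {V : Type*} [Fintype V] {G : SimpleGraph V} {M : G.Subgraph}
    (hM : M.IsMatching) :
    ∃ f, IsMatchInv G f ∧ (∀ x, f x ≠ x ↔ x ∈ M.verts) ∧
      (moved f).card = 2 * M.edgeSet.ncard := by
  classical
  let f : V → V := fun x => if h : x ∈ M.verts then (hM h).choose else x
  have hadj : ∀ x ∈ M.verts, M.Adj x (f x) := by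
    intro x hx
    simp only [f, dif_pos hx]
    exact (hM hx).choose_spec.1
  have hfix : ∀ x, x ∉ M.verts → f x = x := fun x hx => by simp only [f, dif_neg hx]
  have hinv : ∀ x, f (f x) = x := by
    intro x
    by_cases hx : x ∈ M.verts
    · have h1 := hadj x hx
      have h2 := hadj (f x) h1.snd_mem
      exact hM.eq_of_adj_left h2 h1.symm
    · rw [hfix x hx, hfix x hx]
  have hiff : ∀ x, f x ≠ x ↔ x ∈ M.verts := fun x =>
    ⟨fun h => by_contra fun hx => h (hfix x hx), fun hx => (hadj x hx).ne.symm⟩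
  refine ⟨f, ⟨hinv, fun x hx => (hadj x ((hiff x).1 hx)).adj_sub⟩, hiff, ?_⟩
  rw [← two_mul_ncard_orbitGraph f hinv]
  congr 2
  rw [← SimpleGraph.Subgraph.edgeSet_spanningCoe]
  congr 1
  ext x y
  simp only [orbitGraph, SimpleGraph.Subgraph.spanningCoe_adj]
  constructor
  · rintro ⟨h, rfl⟩; exact hadj x ((hiff x).1 h.symm)
  · intro h
    exact ⟨h.ne, hM.eq_of_adj_left (hadj x h.fst_mem) h⟩

lemma exists_isMatching_of_matchInv {V : Type*} [Fintype V] {G : SimpleGraph V} {f : V → V}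
    (hf : IsMatchInv G f) :
    ∃ M : G.Subgraph, M.IsMatching ∧ (moved f).card = 2 * M.edgeSet.ncard := by
  refine ⟨⟨{x | f x ≠ x}, fun x y => x ≠ y ∧ f x = y, ?_, ?_, ?_⟩, ?_, ?_⟩
  · rintro x y ⟨h, rfl⟩; exact hf.2 x h.symm
  · rintro x y ⟨h, rfl⟩; exact h.symm
  · exact ⟨by rintro x y ⟨h, rfl⟩; exact ⟨h.symm, hf.1 x⟩⟩
  · intro x hx
    exact ⟨f x, ⟨Ne.symm hx, rfl⟩, fun y hy => hy.2.symm⟩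
  · rw [← two_mul_ncard_orbitGraph f hf.1, ← SimpleGraph.Subgraph.edgeSet_spanningCoe]
    rfl

lemma le_matchingNumber_iff {V : Type*} [Fintype V] (G : SimpleGraph V) (k : ℕ) :
    k ≤ matchingNumber G ↔ ∃ f, IsMatchInv G f ∧ 2 * k ≤ (moved f).card := by
  have hb := matchingNumber_bddAbove G
  constructor
  · intro h
    -- The empty matching makes the set nonempty, so the supremum is attained by a matching.
    have hne : {k : ℕ | ∃ M : G.Subgraph, M.IsMatching ∧ M.edgeSet.ncard = k}.Nonempty :=
      ⟨_, ⊥, fun v hv => hv.elim, rfl⟩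
    obtain ⟨M, hM, hk⟩ := Nat.sSup_mem hne hb
    obtain ⟨f, hf, -, hc⟩ := exists_matchInv_of_isMatching hM
    refine ⟨f, hf, ?_⟩
    unfold matchingNumber at h
    omega
  · rintro ⟨f, hf, hk⟩
    obtain ⟨M, hM, hc⟩ := exists_isMatching_of_matchInv hf
    have := le_csSup hb ⟨M, hM, rfl⟩
    unfold matchingNumber
    omega

/-! ### Saturation in terms of star-plus-matching configurations -/

/-- Star-plus-matching configuration at `i`: a matching avoiding `i` and a set `L` of neighbours
of `i` that it does not cover, with at least four edges together. -/
def HasConfig {V : Type*} [Fintype V] (G : SimpleGraph V) (i : V) : Prop :=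
  ∃ (L : Finset V) (f : V → V), IsMatchInv G f ∧ f i = i ∧
    (∀ x ∈ L, G.Adj i x ∧ f x = x) ∧ 8 ≤ 2 * L.card + (moved f).card

open Classical in
/-- Restrict a matching to the edges disjoint from `S`. -/
lemma IsMatchInv.avoid {V : Type*} [Fintype V] {G : SimpleGraph V} {f : V → V}
    (hf : IsMatchInv G f) (S : Finset V) :
    ∃ g, IsMatchInv G g ∧ (∀ x ∈ S, g x = x) ∧ (∀ x, f x = x → g x = x) ∧
      (moved f).card ≤ (moved g).card + 2 * (S ∩ moved f).card := by
  let g : V → V := fun x => if x ∈ S ∨ f x ∈ S then x else f x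
  have hg1 : ∀ x, ¬ (x ∈ S ∨ f x ∈ S) → g x = f x := fun x h => if_neg h
  have hg2 : ∀ x, (x ∈ S ∨ f x ∈ S) → g x = x := fun x h => if_pos h
  refine ⟨g, ⟨fun x => ?_, fun x hx => ?_⟩, fun x hx => hg2 x (Or.inl hx), fun x hx => ?_, ?_⟩
  · by_cases h : x ∈ S ∨ f x ∈ S
    · rw [hg2 x h, hg2 x h]
    · have h' : ¬ (f x ∈ S ∨ f (f x) ∈ S) := by rw [hf.1]; tauto
      rw [hg1 x h, hg1 _ h', hf.1]
  · by_cases h : x ∈ S ∨ f x ∈ S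
    · exact absurd (hg2 x h) hx
    · rw [hg1 x h] at hx ⊢
      exact hf.2 x hx
  · by_cases h : x ∈ S ∨ f x ∈ S
    · exact hg2 x h
    · rw [hg1 x h, hx]
  -- A vertex that `g` no longer moves lies in `S` or has its partner there; hence each point of `S
  -- ∩ moved f` costs at most two moved vertices.
  · have hsub : moved f ⊆ moved g ∪ ((S ∩ moved f) ∪ (S ∩ moved f).image f) := by
      intro x hx
      rw [mem_moved] at hx
      simp only [Finset.mem_union, mem_moved, Finset.mem_inter, Finset.mem_image]
      by_cases h1 : x ∈ S
      · exact Or.inr (Or.inl ⟨h1, hx⟩)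
      by_cases h2 : f x ∈ S
      · exact Or.inr (Or.inr ⟨f x, ⟨h2, by rw [hf.1]; exact hx.symm⟩, hf.1 x⟩)
      · left; rwa [hg1 x (by tauto)]
    have h1 := Finset.card_le_card hsub
    have h2 := Finset.card_union_le (moved g) ((S ∩ moved f) ∪ (S ∩ moved f).image f)
    have h3 := Finset.card_union_le (S ∩ moved f) ((S ∩ moved f).image f)
    have h4 : ((S ∩ moved f).image f).card ≤ (S ∩ moved f).card := Finset.card_image_le
    omega

/-- An involution of the complement extends by the identity on `S`; conversely, one fixing `S`
pointwise preserves the complement. -/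
lemma le_matchingNumber_induce_iff {V : Type*} [Fintype V] (G : SimpleGraph V) (S : Set V)
    [Fintype ↑Sᶜ] (k : ℕ) :
    k ≤ matchingNumber (G.induce Sᶜ) ↔
      ∃ f, IsMatchInv G f ∧ (∀ x ∈ S, f x = x) ∧ 2 * k ≤ (moved f).card := by
  classical
  rw [le_matchingNumber_iff]
  constructor
  · rintro ⟨f, hf, hk⟩
    let g : V → V := fun x => if h : x ∈ Sᶜ then f ⟨x, h⟩ else x
    have hg : ∀ x : ↑Sᶜ, g x = f x := fun x => by simp only [g, dif_pos x.2]
    have hg' : ∀ x ∈ S, g x = x := fun x hx => dif_neg (fun h => h hx)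
    refine ⟨g, ⟨fun x => ?_, fun x hx => ?_⟩, hg', hk.trans ?_⟩
    · by_cases h : x ∈ S
      · rw [hg' x h, hg' x h]
      · have := hg ⟨x, h⟩
        simp only at this
        rw [this, hg, hf.1]
    · by_cases h : x ∈ S
      · exact absurd (hg' x h) hx
      · have h1 := hg ⟨x, h⟩
        simp only at h1
        rw [h1] at hx ⊢
        exact hf.2 ⟨x, h⟩ (fun h => hx (congrArg Subtype.val h))
    · refine Finset.card_le_card_of_injOn Subtype.val ?_ Subtype.val_injective.injOn
      intro x hx
      simp only [Finset.mem_coe, mem_moved] at hx ⊢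
      rw [hg]
      exact fun h => hx (Subtype.ext h)
  · rintro ⟨f, hf, hS, hk⟩
    have hmem : ∀ x ∈ Sᶜ, f x ∈ Sᶜ := by
      intro x hx h
      have := hS _ h
      rw [hf.1] at this
      exact hx (this ▸ h)
    refine ⟨fun x => ⟨f x, hmem x x.2⟩, ⟨fun x => Subtype.ext (hf.1 x), fun x hx => ?_⟩,
      hk.trans ?_⟩
    · exact hf.2 x (fun h => hx (Subtype.ext h))
    · have : moved f ⊆ (moved (fun x : ↑Sᶜ => (⟨f x, hmem x x.2⟩ : ↑Sᶜ))).image Subtype.val := by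
        intro x hx
        rw [mem_moved] at hx
        refine Finset.mem_image.2 ⟨⟨x, fun h => hx (hS x h)⟩, ?_, rfl⟩
        rw [mem_moved]
        exact fun h => hx (congrArg Subtype.val h)
      exact (Finset.card_le_card this).trans Finset.card_image_le

/-- Exchange argument: a matching edge destroyed by deleting N(i) has an end in N(i) outside `L`,
and that end is counted as a new edge of the star. -/
lemma HasConfig.four_le {V : Type*} [Fintype V] {G : SimpleGraph V} [DecidableRel G.Adj] {i : V}
    (h : HasConfig G i) : 4 ≤ matchingNumber (G.induce (G.neighborSet i)ᶜ) + G.degree i := by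
  classical
  obtain ⟨L, f, hf, -, hL, hc⟩ := h
  obtain ⟨g, hg, hgS, -, hcard⟩ := hf.avoid (G.neighborFinset i)
  have h1 : L ⊆ G.neighborFinset i := fun x hx => by simpa using (hL x hx).1
  have h2 : G.neighborFinset i ∩ moved f ⊆ G.neighborFinset i \ L := by
    intro x hx
    rw [Finset.mem_inter, mem_moved] at hx
    exact Finset.mem_sdiff.2 ⟨hx.1, fun h => hx.2 (hL x h).2⟩
  have h3 := Finset.card_le_card h2
  rw [Finset.card_sdiff_of_subset h1, SimpleGraph.card_neighborFinset_eq_degree] at h3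
  have h4 := Finset.card_le_card h1
  rw [SimpleGraph.card_neighborFinset_eq_degree] at h4
  obtain ⟨M, hM⟩ : ∃ k, (moved g).card = 2 * k := by
    obtain ⟨M, -, h⟩ := exists_isMatching_of_matchInv hg
    exact ⟨_, h⟩
  have := (le_matchingNumber_induce_iff G (G.neighborSet i) M).2
    ⟨g, hg, fun x hx => hgS x (by simpa using hx), hM.ge⟩
  omega

/-- Reformulation of 4-saturation with involutions. -/
lemma IsSaturating.iff_matchInv {V : Type*} [Fintype V] {G : SimpleGraph V} [DecidableRel G.Adj] :
    IsSaturating G 4 ↔ (∀ f, IsMatchInv G f → (moved f).card < 8) ∧ ∀ i, HasConfig G i := by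
  classical
  have key : matchingNumber G < 4 ↔ ∀ f, IsMatchInv G f → (moved f).card < 8 := by
    rw [← not_le, le_matchingNumber_iff]
    push Not
    rfl
  unfold IsSaturating
  rw [key]
  refine and_congr_right fun hlt => forall_congr' fun i => ⟨fun h => ?_, fun h => h.four_le⟩
  obtain ⟨f, hf, hS, hk⟩ := (le_matchingNumber_induce_iff G (G.neighborSet i) _).1 le_rfl
  have hN : 0 < G.degree i := by
    have := hlt f hf
    omega
  obtain ⟨y, hy⟩ := (G.degree_pos_iff_exists_adj i).1 hN
  refine ⟨G.neighborFinset i, f, hf, ?_, fun x hx => ?_, ?_⟩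
  -- A partner of `i` would lie in N(i), which `f` fixes pointwise.
  · by_contra hi
    have h1 : f (f i) = f i := hS (f i) (hf.2 i hi)
    rw [hf.1] at h1
    exact hi h1.symm
  · rw [SimpleGraph.mem_neighborFinset] at hx
    exact ⟨hx, hS x hx⟩
  · rw [SimpleGraph.card_neighborFinset_eq_degree]
    omega

/-! ### Sufficiency: each of the types is saturating -/

instance {n : ℕ} (E : Finset (Sym2 (Fin n))) : DecidableRel (ofEdges E).Adj := fun a b =>
  decidable_of_iff (s(a, b) ∈ E ∧ a ≠ b) (by simp [ofEdges])

instance : DecidableRel coneOnPentagon.Adj := inferInstanceAs (DecidableRel (ofEdges _).Adj)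
instance : DecidableRel fourTriangles.Adj := inferInstanceAs (DecidableRel (ofEdges _).Adj)
instance : DecidableRel triangularPrism.Adj := inferInstanceAs (DecidableRel (ofEdges _).Adj)
instance : DecidableRel bowtie.Adj := inferInstanceAs (DecidableRel (ofEdges _).Adj)
instance : DecidableRel trianglePentagon.Adj := inferInstanceAs (DecidableRel (ofEdges _).Adj)
instance : DecidableRel twoPentagons.Adj := inferInstanceAs (DecidableRel (ofEdges _).Adj)
instance : DecidableRel threeTriangles.Adj := inferInstanceAs (DecidableRel (ofEdges _).Adj)
instance : DecidableRel trianglesWithPath.Adj := inferInstanceAs (DecidableRel (ofEdges _).Adj)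

/-- A first-order form of `HasConfig`, amenable to `decide`. -/
def HasExplicitConfig {W : Type*} (H : SimpleGraph W) (i : W) : Prop :=
  -- The alternatives have four star edges, three with one matching edge, or two with two. A single
  -- star edge with three disjoint matching edges would already be a matching of size four.
  ∃ a, H.Adj i a ∧ ∃ b, H.Adj i b ∧ a ≠ b ∧
    ((∃ c, H.Adj i c ∧ (c ≠ a ∧ c ≠ b) ∧
      ((∃ d, H.Adj i d ∧ (d ≠ a ∧ d ≠ b ∧ d ≠ c)) ∨
        ∃ p, (p ≠ i ∧ p ≠ a ∧ p ≠ b ∧ p ≠ c) ∧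
          ∃ q, H.Adj p q ∧ (q ≠ i ∧ q ≠ a ∧ q ≠ b ∧ q ≠ c))) ∨
     (∃ p, (p ≠ i ∧ p ≠ a ∧ p ≠ b) ∧ ∃ q, H.Adj p q ∧ (q ≠ i ∧ q ≠ a ∧ q ≠ b) ∧
        ∃ r, (r ≠ i ∧ r ≠ a ∧ r ≠ b ∧ r ≠ p ∧ r ≠ q) ∧
          ∃ s, H.Adj r s ∧ (s ≠ i ∧ s ≠ a ∧ s ≠ b ∧ s ≠ p ∧ s ≠ q)))

set_option synthInstance.maxSize 2000 in
set_option synthInstance.maxHeartbeats 400000 in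
instance {W : Type*} [Fintype W] [DecidableEq W] (H : SimpleGraph W) [DecidableRel H.Adj] (i : W) :
    Decidable (HasExplicitConfig H i) := by
  unfold HasExplicitConfig; infer_instance

lemma HasExplicitConfig.hasConfig {V : Type*} [Fintype V] {G : SimpleGraph V} {i : V}
    (h : HasExplicitConfig G i) : HasConfig G i := by
  classical
  have hid : IsMatchInv G id := ⟨fun _ => rfl, fun x hx => absurd rfl hx⟩
  have hswap : ∀ p q, G.Adj p q → IsMatchInv G (Equiv.swap p q) := by
    intro p q hpq
    refine ⟨Equiv.swap_apply_self p q, fun x hx => ?_⟩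
    by_cases h1 : x = p
    · subst h1; simpa using hpq
    by_cases h2 : x = q
    · subst h2; simpa using hpq.symm
    · exact absurd (Equiv.swap_apply_of_ne_of_ne h1 h2) hx
  obtain ⟨a, ha, b, hb, hab, ⟨c, hc, hc', ⟨d, hd, hd'⟩ | ⟨p, hp, q, hpq, hq⟩⟩ |
    ⟨p, hp, q, hpq, hq, r, hr, s, hrs, hs⟩⟩ := h
  · refine ⟨{a, b, c, d}, id, hid, rfl, ?_, ?_⟩
    · simp only [Finset.mem_insert, Finset.mem_singleton]
      rintro x (rfl | rfl | rfl | rfl) <;> exact ⟨by assumption, rfl⟩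
    · have : ({a, b, c, d} : Finset V).card = 4 := Finset.card_eq_of_equiv_fin (by
        exact (Finset.equivFinOfCardEq (by grind)))
      omega
  · refine ⟨{a, b, c}, Equiv.swap p q, hswap p q hpq, ?_, ?_, ?_⟩
    · exact Equiv.swap_apply_of_ne_of_ne hp.1.symm hq.1.symm
    · simp only [Finset.mem_insert, Finset.mem_singleton]
      rintro x (rfl | rfl | rfl) <;>
        exact ⟨by assumption, Equiv.swap_apply_of_ne_of_ne (by tauto) (by tauto)⟩
    · have h1 : ({a, b, c} : Finset V).card = 3 := by
        rw [Finset.card_eq_three]; exact ⟨a, b, c, hab, hc'.1.symm, hc'.2.symm, rfl⟩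
      have h2 : ({p, q} : Finset V) ⊆ moved (Equiv.swap p q) := by
        simp only [Finset.insert_subset_iff, Finset.singleton_subset_iff, mem_moved,
          Equiv.swap_apply_left, Equiv.swap_apply_right]
        exact ⟨hpq.ne.symm, hpq.ne⟩
      have h3 := Finset.card_le_card h2
      rw [Finset.card_pair hpq.ne] at h3
      omega
  · have hpr : ∀ x, x ≠ r → x ≠ s → (Equiv.swap r s) x = x := fun x =>
      Equiv.swap_apply_of_ne_of_ne
    have hpq' : ∀ x, x ≠ p → x ≠ q → (Equiv.swap p q) x = x := fun x =>
      Equiv.swap_apply_of_ne_of_ne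
    have hdisj : (Equiv.swap p q).Disjoint (Equiv.swap r s) := by
      intro x
      by_cases h1 : x = p
      · right; subst h1; exact hpr _ (by tauto) (by tauto)
      by_cases h2 : x = q
      · right; subst h2; exact hpr _ (by tauto) (by tauto)
      · left; exact hpq' _ h1 h2
    refine ⟨{a, b}, fun x => Equiv.swap p q (Equiv.swap r s x), ⟨fun x => ?_, fun x hx => ?_⟩,
      ?_, ?_, ?_⟩
    · have := hdisj.commute.eq
      have h := DFunLike.congr_fun this (Equiv.swap r s x)
      simp only [Equiv.Perm.mul_apply, Equiv.swap_apply_self] at h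
      change Equiv.swap p q (Equiv.swap r s (Equiv.swap p q (Equiv.swap r s x))) = x
      rw [← h]
      simp
    · change Equiv.swap p q (Equiv.swap r s x) ≠ x at hx
      change G.Adj x (Equiv.swap p q (Equiv.swap r s x))
      rcases hdisj x with h | h
      · by_cases h' : Equiv.swap r s x = x
        · rw [h', h] at hx; exact absurd rfl hx
        · have h2 : Equiv.swap p q (Equiv.swap r s x) = Equiv.swap r s x := by
            rcases hdisj (Equiv.swap r s x) with h3 | h3
            · exact h3
            · rw [Equiv.swap_apply_self] at h3; exact absurd h3.symm h'
          rw [h2]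
          exact (hswap r s hrs).2 x h'
      · rw [h] at hx ⊢
        exact (hswap p q hpq).2 x hx
    · change Equiv.swap p q (Equiv.swap r s i) = i
      rw [hpr _ (by tauto) (by tauto), hpq' _ (by tauto) (by tauto)]
    · simp only [Finset.mem_insert, Finset.mem_singleton]
      rintro x (rfl | rfl) <;> refine ⟨by assumption, ?_⟩ <;>
        rw [hpr _ (by tauto) (by tauto), hpq' _ (by tauto) (by tauto)]
    · have h2 : ({p, q, r, s} : Finset V) ⊆
          moved (fun x => Equiv.swap p q (Equiv.swap r s x)) := by
        have hp1 := hpr p (by tauto) (by tauto)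
        have hq1 := hpr q (by tauto) (by tauto)
        have hr1 := hpq' r (by tauto) (by tauto)
        have hs1 := hpq' s (by tauto) (by tauto)
        simp only [Finset.insert_subset_iff, Finset.singleton_subset_iff, mem_moved, hp1, hq1, hr1,
          hs1, Equiv.swap_apply_left, Equiv.swap_apply_right]
        exact ⟨hpq.ne.symm, hpq.ne, hrs.ne.symm, hrs.ne⟩
      have h3 := Finset.card_le_card h2
      have h4 : ({p, q, r, s} : Finset V).card = 4 := by
        have := hpq.ne; have := hrs.ne
        grind
      rw [Finset.card_pair hab]
      omega

/-- Only preservation of adjacency is used, so extra edges in `G` do no harm; this is why it is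
enough to look at spanning templates. -/
lemma HasConfig.map {V W : Type*} [Fintype V] [Fintype W] {G : SimpleGraph V} {H : SimpleGraph W}
    (φ : H →g G) (hφ : Function.Bijective φ) {j : W} (h : HasConfig H j) : HasConfig G (φ j) := by
  classical
  obtain ⟨L, f, hf, hj, hL, hc⟩ := h
  let e : W ≃ V := Equiv.ofBijective φ hφ
  have he : ∀ x, e x = φ x := fun x => rfl
  refine ⟨L.map e.toEmbedding, fun x => e (f (e.symm x)), ⟨fun x => ?_, fun x hx => ?_⟩, ?_, ?_, ?_⟩
  · simp [hf.1]
  · obtain ⟨w, rfl⟩ := e.surjective x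
    simp only [Equiv.symm_apply_apply, ne_eq, EmbeddingLike.apply_eq_iff_eq] at hx ⊢
    exact φ.map_adj (hf.2 w hx)
  · rw [← he]; simp [hj]
  · intro x hx
    obtain ⟨w, hw, rfl⟩ := Finset.mem_map.1 hx
    exact ⟨φ.map_adj (hL w hw).1, by simp [(hL w hw).2]⟩
  · have : moved f ⊆ (moved (fun x => e (f (e.symm x)))).map e.symm.toEmbedding := by
      intro x hx
      rw [Finset.mem_map_equiv]
      simpa using hx
    have h2 := Finset.card_le_card this
    rw [Finset.card_map] at h2 ⊢
    omega

lemma HasConfig.of_spanning {V W : Type*} [Fintype V] [Fintype W] {G : SimpleGraph V}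
    {H : SimpleGraph W} (h : IsSpannedBy G H) (hH : ∀ j, HasExplicitConfig H j) (i : V) :
    HasConfig G i := by
  obtain ⟨φ, hφ⟩ := h
  obtain ⟨j, rfl⟩ := hφ.2 i
  exact (hH j).hasConfig.map φ hφ

/-- Four disjoint edges need eight vertices, so only the configurations have to be checked. -/
lemma isSaturating_of_spanning {V W : Type*} [Fintype V] [Fintype W] {G : SimpleGraph V}
    [DecidableRel G.Adj] {H : SimpleGraph W} (h : IsSpannedBy G H)
    (hW : Fintype.card W < 8) (hH : ∀ j, HasExplicitConfig H j) : IsSaturating G 4 := by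
  refine IsSaturating.iff_matchInv.2 ⟨fun f _ => ?_, HasConfig.of_spanning h hH⟩
  obtain ⟨φ, hφ⟩ := h
  have := Fintype.card_of_bijective hφ
  have := (moved f).card_le_univ
  omega

lemma IsSpannedBy.of_iso {V W : Type*} {G : SimpleGraph V} {H : SimpleGraph W}
    (h : Nonempty (G ≃g H)) : IsSpannedBy G H :=
  h.elim fun e => ⟨e.symm.toHom, e.symm.bijective⟩

/-- A matching misses a vertex of the summand `H` when `H` has odd order. -/
lemma exists_fixed_of_summand {V W X : Type*} [Fintype W] {G : SimpleGraph V}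
    {H : SimpleGraph W} {K : SimpleGraph X} (e : G ≃g H ⊕g K) (hodd : Odd (Fintype.card W))
    {f : V → V} (hf : IsMatchInv G f) : ∃ w, f (e.symm (.inl w)) = e.symm (.inl w) := by
  classical
  let s : Finset V := Finset.univ.image fun w : W => e.symm (.inl w)
  have hinj : Function.Injective fun w : W => e.symm (.inl w) :=
    e.symm.injective.comp Sum.inl_injective
  have hs : ∀ x ∈ s, f x ∈ s := by
    intro x hx
    obtain ⟨w, -, rfl⟩ := Finset.mem_image.1 hx
    by_cases hm : f (e.symm (.inl w)) = e.symm (.inl w)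
    · rwa [hm]
    · have h := e.map_adj_iff.2 (hf.2 _ hm)
      rw [RelIso.apply_symm_apply] at h
      rcases hz : e (f (e.symm (.inl w))) with z | z
      · rw [← e.symm_apply_apply (f _), hz]
        exact Finset.mem_image_of_mem _ (Finset.mem_univ z)
      · rw [hz] at h
        simp at h
  obtain ⟨x, hx, hfx⟩ := exists_fixed_of_odd s f hs (fun x _ => hf.1 x)
    (by rwa [Finset.card_image_of_injective _ hinj, Finset.card_univ])
  obtain ⟨w, -, rfl⟩ := Finset.mem_image.1 hx
  exact ⟨w, hfx⟩

/-- Each of two disjoint odd summands misses a vertex, so at most 9 - 2 = 7 vertices are moved. -/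
lemma isSaturating_of_two_odd_summands {V W X Y Z : Type*} [Fintype V] [Fintype W] [Fintype X]
    {G : SimpleGraph V} [DecidableRel G.Adj] {H : SimpleGraph W} {K : SimpleGraph X}
    {H' : SimpleGraph Y} {K' : SimpleGraph Z} (e : G ≃g H ⊕g H') (e' : G ≃g K ⊕g K')
    (he : ∀ w x, e.symm (.inl w) ≠ e'.symm (.inl x))
    (hodd : Odd (Fintype.card W)) (hodd' : Odd (Fintype.card X)) (hV : Fintype.card V ≤ 9)
    (hc : ∀ i, HasConfig G i) : IsSaturating G 4 := by
  refine IsSaturating.iff_matchInv.2 ⟨fun f hf => ?_, hc⟩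
  classical
  obtain ⟨w, hw⟩ := exists_fixed_of_summand e hodd hf
  obtain ⟨x, hx⟩ := exists_fixed_of_summand e' hodd' hf
  have h1 : moved f ⊆ Finset.univ \ {e.symm (.inl w), e'.symm (.inl x)} := by
    intro y hy
    rw [mem_moved] at hy
    simp only [Finset.mem_sdiff, Finset.mem_univ, Finset.mem_insert, Finset.mem_singleton,
      true_and]
    rintro (rfl | rfl)
    · exact hy hw
    · exact hy hx
  have h2 := Finset.card_le_card h1
  rw [Finset.card_sdiff_of_subset (Finset.subset_univ _), Finset.card_pair (he w x),
    Finset.card_univ] at h2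
  omega

lemma isSaturating_of_triangle_sum {V : Type*} [Fintype V] {G : SimpleGraph V} [DecidableRel G.Adj]
    {H F : SimpleGraph (Fin 5)} (hs : IsSpannedBy H F) (hG : Nonempty (G ≃g K 3 ⊕g H))
    (hF : ∀ j, HasExplicitConfig (K 3 ⊕g F) j) : IsSaturating G 4 := by
  obtain ⟨e⟩ := hG
  obtain ⟨φ, hφ⟩ := hs
  refine isSaturating_of_two_odd_summands e (e.trans Iso.sumComm) (fun w x h => ?_)
    (by decide) (by decide) ?_ (HasConfig.of_spanning (H := K 3 ⊕g F) ?_ hF)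
  · have := congrArg e h
    simp at this
  · rw [Fintype.card_congr e.toEquiv]; simp
  · refine ⟨e.symm.toHom.comp (Hom.sum Hom.id φ), e.symm.bijective.comp ?_⟩
    exact ⟨Function.injective_id.sumMap hφ.1, Function.surjective_id.sumMap hφ.2⟩

instance {V W : Type*} (G : SimpleGraph V) (H : SimpleGraph W) [DecidableRel G.Adj]
    [DecidableRel H.Adj] : DecidableRel (G ⊕g H).Adj
  | .inl a, .inl b => decidable_of_iff (G.Adj a b) (by simp)
  | .inr a, .inr b => decidable_of_iff (H.Adj a b) (by simp)
  | .inl _, .inr _ => isFalse (by simp)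
  | .inr _, .inl _ => isFalse (by simp)

lemma isSaturating_of_three_triangle_sum {V : Type*} [Fintype V] {G : SimpleGraph V}
    [DecidableRel G.Adj] (hG : Nonempty (G ≃g K 3 ⊕g K 3 ⊕g K 3)) : IsSaturating G 4 := by
  obtain ⟨e⟩ := hG
  -- Reassociating puts the first triangle on the left, swapping puts the third one there.
  refine isSaturating_of_two_odd_summands (e.trans Iso.sumAssoc) (e.trans Iso.sumComm)
    (fun w x h => ?_) (by decide) (by decide) ?_
    (HasConfig.of_spanning (IsSpannedBy.of_iso ⟨e⟩) (by decide +kernel))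
  · have := congrArg e h
    simp [Iso.sumAssoc] at this
  · rw [Fintype.card_congr e.toEquiv]; simp

/-! ### Barriers, Tutte's theorem and deficiency -/

/-- `D` is disjoint from `A`, and every neighbour of `D` lies in `D` or in `A`. -/
def IsClosedMod {V : Type*} (G : SimpleGraph V) (A D : Finset V) : Prop :=
  Disjoint D A ∧ ∀ x ∈ D, ∀ y, G.Adj x y → y ∈ D ∨ y ∈ A

/-- A family `P` of pairwise disjoint odd sets of vertices, each closed modulo `A`. -/
structure IsBarrier {V : Type*} (G : SimpleGraph V) (A : Finset V) (P : Finset (Finset V)) :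
    Prop where
  closed : ∀ D ∈ P, IsClosedMod G A D
  odd : ∀ D ∈ P, Odd D.card
  disj : ∀ D ∈ P, ∀ D' ∈ P, D ≠ D' → Disjoint D D'

open Classical in
lemma IsBarrier.card_add_sum_le {V : Type*} [Fintype V] {G : SimpleGraph V} {A : Finset V}
    {P : Finset (Finset V)} (h : IsBarrier G A P) :
    (P.biUnion id).card = ∑ D ∈ P, D.card ∧ Disjoint (P.biUnion id) A := by
  refine ⟨Finset.card_biUnion fun D hD D' hD' hne => h.disj D hD D' hD' hne, ?_⟩
  rw [Finset.disjoint_biUnion_left]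
  exact fun D hD => (h.closed D hD).1

lemma sum_card_mod_two {V : Type*} (P : Finset (Finset V)) (h : ∀ D ∈ P, Odd D.card) :
    (∑ D ∈ P, D.card) % 2 = P.card % 2 := by
  rw [Finset.sum_nat_mod, Finset.sum_congr rfl fun D hD => Nat.odd_iff.1 (h D hD)]
  simp

/-- The odd components left by a Tutte violator form a barrier. -/
lemma exists_isBarrier_lt {W : Type*} [Fintype W] (X : SimpleGraph W)
    (h : ¬ ∃ f, IsMatchInv X f ∧ ∀ x, f x ≠ x) :
    ∃ A P, IsBarrier X A P ∧ A.card < P.card := by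
  classical
  have h1 : ¬ ∃ M : X.Subgraph, M.IsPerfectMatching := by
    rintro ⟨M, hM, hs⟩
    obtain ⟨f, hf, hv, -⟩ := exists_matchInv_of_isMatching hM
    exact h ⟨f, hf, fun x => (hv x).2 (hs x)⟩
  rw [SimpleGraph.tutte] at h1
  push Not at h1
  obtain ⟨u, hu⟩ := h1
  unfold IsTutteViolator at hu
  set Y := ((⊤ : X.Subgraph).deleteVerts u).coe with hY
  let φ : Y.ConnectedComponent → Finset W := fun c => (Subtype.val '' c.supp).toFinset
  have hmem : ∀ c x, x ∈ φ c ↔ ∃ h : x ∈ ((⊤ : X.Subgraph).deleteVerts u).verts,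
      Y.connectedComponentMk ⟨x, h⟩ = c := by
    intro c x
    simp [φ]
  have hcard : ∀ c, (φ c).card = c.supp.ncard := by
    intro c
    rw [← Set.ncard_eq_toFinset_card', Set.ncard_image_of_injective _ Subtype.val_injective]
  have hinj : Function.Injective φ := by
    intro c c' hcc
    obtain ⟨x, rfl⟩ := c.exists_rep
    have := (hmem (Y.connectedComponentMk x) x).2 ⟨x.2, rfl⟩
    change x.1 ∈ φ (Quot.mk _ x) at this
    rw [hcc, hmem] at this
    exact this.2
  refine ⟨u.toFinset, Y.oddComponents.toFinset.image φ, ⟨?_, ?_, ?_⟩, ?_⟩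
  · intro D hD
    obtain ⟨c, -, rfl⟩ := Finset.mem_image.1 hD
    refine ⟨Finset.disjoint_left.2 fun x hx hxu => ?_, fun x hx y hxy => ?_⟩
    · obtain ⟨hx', -⟩ := (hmem c x).1 hx
      exact hx'.2 (by simpa using hxu)
    · obtain ⟨hx', rfl⟩ := (hmem _ x).1 hx
      by_cases hy : y ∈ u
      · right; simpa using hy
      · left
        rw [hmem]
        refine ⟨⟨trivial, hy⟩, ?_⟩
        rw [SimpleGraph.ConnectedComponent.eq]
        refine SimpleGraph.Adj.reachable ?_
        rw [hY]
        simp only [Subgraph.coe_adj, Subgraph.deleteVerts_adj, Subgraph.verts_top, Set.mem_univ,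
          Subgraph.top_adj, true_and]
        exact ⟨hy, hx'.2, hxy.symm⟩
  · intro D hD
    obtain ⟨c, hc, rfl⟩ := Finset.mem_image.1 hD
    rw [hcard]
    simpa using hc
  · intro D hD D' hD' hne
    obtain ⟨c, -, rfl⟩ := Finset.mem_image.1 hD
    obtain ⟨c', -, rfl⟩ := Finset.mem_image.1 hD'
    refine Finset.disjoint_left.2 fun x hx hx' => hne ?_
    obtain ⟨_, rfl⟩ := (hmem c x).1 hx
    obtain ⟨_, rfl⟩ := (hmem c' x).1 hx'
    rfl
  · rw [Finset.card_image_of_injective _ hinj, ← Set.ncard_eq_toFinset_card',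
      ← Set.ncard_eq_toFinset_card']
    exact hu

/-- In even order, the deficiency of a barrier can be improved to at least two. -/
lemma exists_isBarrier {W : Type*} [Fintype W] (X : SimpleGraph W) (heven : Even (Fintype.card W))
    (h : ¬ ∃ f, IsMatchInv X f ∧ ∀ x, f x ≠ x) :
    ∃ A P, IsBarrier X A P ∧ A.card + 2 ≤ P.card := by
  classical
  obtain ⟨A, P, hP, hlt⟩ := exists_isBarrier_lt X h
  by_cases h2 : A.card + 2 ≤ P.card
  · exact ⟨A, P, hP, h2⟩
  obtain ⟨h3, h4⟩ := hP.card_add_sum_le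
  -- If |P| = |A| + 1, parity makes the set of leftover vertices odd. No edge joins it to a block,
  -- so it is one more block.
  set R : Finset W := (P.biUnion id ∪ A)ᶜ with hR
  have hRmem : ∀ x, x ∈ R ↔ (∀ D ∈ P, x ∉ D) ∧ x ∉ A := by
    intro x; simp [hR]
  have hc := Finset.card_add_card_compl (P.biUnion id ∪ A)
  rw [← hR, Finset.card_union_of_disjoint h4, h3] at hc
  have hm := sum_card_mod_two P hP.odd
  have hodd : Odd R.card := by
    rw [Nat.odd_iff]
    rw [Nat.even_iff] at heven
    omega
  have hRP : ∀ D ∈ P, Disjoint R D := fun D hD =>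
    Finset.disjoint_left.2 fun x hx => ((hRmem x).1 hx).1 D hD
  have hnot : R ∉ P := by
    intro hmem
    have := hRP R hmem
    rw [disjoint_self] at this
    rw [this] at hodd
    simp at hodd
  refine ⟨A, insert R P, ⟨?_, ?_, ?_⟩, ?_⟩
  · intro D hD
    rcases Finset.mem_insert.1 hD with rfl | hD
    · refine ⟨Finset.disjoint_left.2 fun x hx => ((hRmem x).1 hx).2, fun x hx y hxy => ?_⟩
      by_contra hy
      rw [hRmem] at hx hy
      push Not at hy
      obtain ⟨D, hD, hyD⟩ : ∃ D ∈ P, y ∈ D := by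
        by_contra! hno
        exact hy.2 (hy.1 hno)
      rcases (hP.closed D hD).2 y hyD x hxy.symm with h | h
      · exact hx.1 D hD h
      · exact hx.2 h
    · exact hP.closed D hD
  · intro D hD
    rcases Finset.mem_insert.1 hD with rfl | hD
    · exact hodd
    · exact hP.odd D hD
  · intro D hD D' hD' hne
    rcases Finset.mem_insert.1 hD with rfl | hD <;> rcases Finset.mem_insert.1 hD' with rfl | hD'
    · exact absurd rfl hne
    · exact hRP _ hD'
    · exact (hRP _ hD).symm
    · exact hP.disj _ hD _ hD' hne
  · rw [Finset.card_insert_of_notMem hnot]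
    omega

open Classical in
/-- Counting the vertices missed by the matching of a configuration at a vertex of a set closed
modulo `A`. -/
lemma HasConfig.card_neighbors_ge {V : Type*} [Fintype V] {G : SimpleGraph V} {A E : Finset V}
    {P : Finset (Finset V)} {i : V} (hc : HasConfig G i) (hP : IsBarrier G A P)
    (hE : IsClosedMod G A E) (hdisj : ∀ D ∈ P, Disjoint E D) (hi : i ∈ E) :
    9 + P.card ≤ (E.filter (G.Adj i)).card + Fintype.card V + A.card := by
  obtain ⟨L, f, hf, hfi, hL, hcard⟩ := hc
  -- An odd block cannot be matched entirely within itself.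
  have hex : ∀ D ∈ P, ∃ x ∈ D, f x = x ∨ f x ∈ A := by
    intro D hD
    by_contra! hno
    refine Nat.not_even_iff_odd.2 (hP.odd D hD) (even_card_of_invol D f (fun x hx => ?_)
      (fun x _ => hf.1 x) fun x hx => (hno x hx).1)
    exact ((hP.closed D hD).2 x hx _ (hf.2 x (hno x hx).1)).resolve_right (hno x hx).2
  have : Nonempty V := ⟨i⟩
  choose! g hgD hg using hex
  -- Each block contributes its own point: an unmatched vertex other than `i` and `L`, or a vertex
  -- of `A` outside `L`.
  have himage : P.image (fun D => f (g D)) ⊆ ((moved f)ᶜ \ insert i L) ∪ (A \ L) := by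
    intro y hy
    obtain ⟨D, hD, rfl⟩ := Finset.mem_image.1 hy
    have hgA : g D ∉ A := Finset.disjoint_left.1 (hP.closed D hD).1 (hgD D hD)
    have hgE : g D ∉ E := fun h => Finset.disjoint_left.1 (hdisj D hD) h (hgD D hD)
    have hfL : f (g D) ∈ L → f (g D) = g D ∧ g D ∈ L := by
      intro h
      have h1 := (hL _ h).2
      rw [hf.1] at h1
      exact ⟨h1.symm, h1 ▸ h⟩
    have hgL : g D ∉ L := by
      intro h
      rcases hE.2 i hi _ (hL _ h).1 with h | h
      · exact hgE h
      · exact hgA h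
    have hfgL : f (g D) ∉ L := fun h => hgL (hfL h).2
    rcases hg D hD with h | h
    · refine Finset.mem_union_left _ (Finset.mem_sdiff.2 ⟨?_, ?_⟩)
      · rw [Finset.mem_compl, mem_moved, h]; exact fun hn => hn h
      · rw [h, Finset.mem_insert]
        rintro (h' | h')
        · exact hgE (h' ▸ hi)
        · exact hgL h'
    · exact Finset.mem_union_right _ (Finset.mem_sdiff.2 ⟨h, hfgL⟩)
  have hinj : Set.InjOn (fun D => f (g D)) (P : Set (Finset V)) := by
    intro D hD D' hD' heq
    have h1 : g D = g D' := by
      have := congrArg f heq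
      simpa only [hf.1] using this
    by_contra hne
    exact Finset.disjoint_left.1 (hP.disj D hD D' hD' hne) (hgD D hD) (h1 ▸ hgD D' hD')
  have h1 := Finset.card_le_card himage
  rw [Finset.card_image_of_injOn hinj] at h1
  have h2 := Finset.card_union_le ((moved f)ᶜ \ insert i L) (A \ L)
  have hiL : i ∉ L := fun h => (hL i h).1.ne rfl
  have hsub : insert i L ⊆ (moved f)ᶜ := by
    intro x hx
    rw [Finset.mem_compl, mem_moved, not_not]
    rcases Finset.mem_insert.1 hx with rfl | hx
    · exact hfi
    · exact (hL x hx).2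
  have h3 := Finset.card_le_card hsub
  rw [Finset.card_sdiff_of_subset hsub, Finset.card_insert_of_notMem hiL] at h2
  rw [Finset.card_insert_of_notMem hiL] at h3
  have h4 := Finset.card_add_card_compl (moved f)
  have h5 := Finset.card_sdiff_add_card_inter A L
  -- The part of `L` inside `A` cancels against the loss in `A \ L`, so only the neighbours of `i`
  -- within `E` remain in the bound.
  have h6 : L ⊆ (A ∩ L) ∪ E.filter (G.Adj i) := by
    intro x hx
    rcases hE.2 i hi x (hL x hx).1 with h | h
    · exact Finset.mem_union_right _ (Finset.mem_filter.2 ⟨h, (hL x hx).1⟩)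
    · exact Finset.mem_union_left _ (Finset.mem_inter.2 ⟨h, hx⟩)
  have h7 := (Finset.card_le_card h6).trans (Finset.card_union_le _ _)
  omega

/-- A graph of order at least eight whose matchings have at most three edges has a barrier of
large deficiency. -/
lemma exists_isBarrier_of_eight_le {V : Type*} [Fintype V] (G : SimpleGraph V)
    (hV : 8 ≤ Fintype.card V) (hlt : ∀ f, IsMatchInv G f → (moved f).card < 8) :
    ∃ A P, IsBarrier G A P ∧ A.card + Fintype.card V ≤ P.card + 6 := by
  classical
  obtain ⟨d, hd⟩ := Nat.exists_eq_add_of_le hV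
  -- Berge's device: join `G` with `d = |V| - 8` universal vertices, making the order 8 + 2d.
  let X : SimpleGraph (V ⊕ Fin d) := (G ⊕g ⊤) ⊔ completeBipartiteGraph V (Fin d)
  have hXG : ∀ a b, X.Adj (.inl a) (.inl b) ↔ G.Adj a b := by simp [X]
  have hXr : ∀ a e, a ≠ .inr e → X.Adj a (.inr e) := by
    rintro (a | a) e h
    · simp [X]
    · simp only [X, SimpleGraph.sup_adj, sum_adj_inr, top_adj]
      exact Or.inl fun h' => h (h' ▸ rfl)
  -- In a perfect matching of `X` at most `d` old vertices have new partners, so at least eight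
  -- would be matched inside `G`.
  have hno : ¬ ∃ f, IsMatchInv X f ∧ ∀ x, f x ≠ x := by
    rintro ⟨f, hf, hne⟩
    let g : V → V := fun x => (f (.inl x)).elim id fun _ => x
    have hgl : ∀ x y, f (.inl x) = .inl y → g x = y := fun x y h => by simp [g, h]
    have hgr : ∀ x e, f (.inl x) = .inr e → g x = x := fun x y h => by simp [g, h]
    have hg : IsMatchInv G g := by
      refine ⟨fun x => ?_, fun x hx => ?_⟩
      · rcases h : f (.inl x) with y | e
        · rw [hgl x y h]
          exact hgl y x (by rw [← h, hf.1])
        · rw [hgr x e h, hgr x e h]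
      · rcases h : f (.inl x) with y | e
        · rw [hgl x y h, ← hXG, ← h]
          exact hf.2 _ (hne _)
        · exact absurd (hgr x e h) hx
    have h1 := hlt g hg
    have h2 : ((moved g)ᶜ.image fun x => f (.inl x)) ⊆ Finset.univ.image Sum.inr := by
      intro z hz
      obtain ⟨x, hx, rfl⟩ := Finset.mem_image.1 hz
      rw [Finset.mem_compl, mem_moved, not_not] at hx
      rcases h : f (.inl x) with y | e
      · have := hgl x y h
        rw [hx] at this
        exact absurd (this ▸ h) (hne _)
      · exact Finset.mem_image_of_mem _ (Finset.mem_univ e)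
    have h3 := Finset.card_le_card h2
    have hinj : Function.Injective fun x => f (.inl x) := fun x y hxy => by
      have := congrArg f hxy
      simp only [hf.1] at this
      exact Sum.inl_injective this
    rw [Finset.card_image_of_injective _ hinj, Finset.card_image_of_injective _ Sum.inr_injective,
      Finset.card_univ, Fintype.card_fin] at h3
    have h4 := Finset.card_add_card_compl (moved g)
    omega
  obtain ⟨S, P, hP, hc⟩ := exists_isBarrier X
    (by rw [Fintype.card_sum, Fintype.card_fin, hd]; exact ⟨4 + d, by ring⟩) hno
  -- A universal vertex outside `S` would belong to every block, but there are at least two disjoint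
  -- ones.
  have hS : ∀ e : Fin d, .inr e ∈ S := by
    intro e
    by_contra he
    have hall : ∀ D ∈ P, .inr e ∈ D := by
      intro D hD
      obtain ⟨x, hx⟩ := Finset.card_pos.1 (hP.odd D hD).pos
      by_cases hxe : x = .inr e
      · exact hxe ▸ hx
      · exact ((hP.closed D hD).2 x hx _ (hXr x e hxe)).resolve_right he
    have : P.card ≤ 1 := by
      rw [Finset.card_le_one]
      intro D hD D' hD'
      by_contra hne
      exact Finset.disjoint_left.1 (hP.disj D hD D' hD' hne) (hall D hD) (hall D' hD')
    omega
  have hDr : ∀ D ∈ P, D.toRight = ∅ := by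
    intro D hD
    refine Finset.eq_empty_of_forall_notMem fun e he => ?_
    exact Finset.disjoint_left.1 (hP.closed D hD).1 (Finset.mem_toRight.1 he) (hS e)
  have hDcard : ∀ D ∈ P, D.toLeft.card = D.card := by
    intro D hD
    have := D.card_toLeft_add_card_toRight
    rw [hDr D hD] at this
    simpa using this
  have hdis : ∀ D ∈ P, ∀ D' ∈ P, D ≠ D' → Disjoint D.toLeft D'.toLeft := by
    intro D hD D' hD' hne
    refine Finset.disjoint_left.2 fun x hx hx' => ?_
    exact Finset.disjoint_left.1 (hP.disj D hD D' hD' hne) (Finset.mem_toLeft.1 hx)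
      (Finset.mem_toLeft.1 hx')
  have hinj : Set.InjOn Finset.toLeft (P : Set (Finset (V ⊕ Fin d))) := by
    intro D hD D' hD' heq
    by_contra hne
    have h1 := hdis D hD D' hD' hne
    rw [heq, disjoint_self] at h1
    have h2 := hDcard D' hD'
    rw [h1] at h2
    have h3 := (hP.odd D' hD').pos
    simp at h2
    omega
  refine ⟨S.toLeft, P.image Finset.toLeft, ⟨?_, ?_, ?_⟩, ?_⟩
  · intro E hE
    obtain ⟨D, hD, rfl⟩ := Finset.mem_image.1 hE
    refine ⟨Finset.disjoint_left.2 fun x hx hx' => ?_, fun x hx y hxy => ?_⟩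
    · exact Finset.disjoint_left.1 (hP.closed D hD).1 (Finset.mem_toLeft.1 hx)
        (Finset.mem_toLeft.1 hx')
    · simpa using (hP.closed D hD).2 _ (Finset.mem_toLeft.1 hx) _ ((hXG x y).2 hxy)
  · intro E hE
    obtain ⟨D, hD, rfl⟩ := Finset.mem_image.1 hE
    rw [hDcard D hD]
    exact hP.odd D hD
  · intro E hE E' hE' hne
    obtain ⟨D, hD, rfl⟩ := Finset.mem_image.1 hE
    obtain ⟨D', hD', rfl⟩ := Finset.mem_image.1 hE'
    exact hdis D hD D' hD' fun h => hne (h ▸ rfl)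
  -- Removing the `d` universal vertices from `S` turns |S| + 2 ≤ |P| into the claim, since |V| = 8
  -- + d.
  · rw [Finset.card_image_of_injOn hinj]
    have h1 := S.card_toLeft_add_card_toRight
    have h2 : S.toRight = Finset.univ :=
      Finset.eq_univ_of_forall fun e => Finset.mem_toRight.2 (hS e)
    rw [h2, Finset.card_univ, Fintype.card_fin] at h1
    omega

/-- In odd order, either some matching misses precisely `v`, or there is a barrier through `v`. -/
lemma exists_nearPerfect_or_isBarrier {V : Type*} [Fintype V] (G : SimpleGraph V)
    (hodd : Odd (Fintype.card V)) (v : V) :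
    (∃ f, IsMatchInv G f ∧ f v = v ∧ ∀ x, x ≠ v → f x ≠ x) ∨
      ∃ A P, IsBarrier G A P ∧ v ∈ A ∧ A.card + 1 ≤ P.card := by
  classical
  let ι : {x // x ≠ v} ↪ V := Function.Embedding.subtype _
  by_cases h : ∃ f, IsMatchInv (G.comap ι) f ∧ ∀ x, f x ≠ x
  · left
    obtain ⟨f, hf, hne⟩ := h
    let g : V → V := fun x => if h : x ≠ v then f ⟨x, h⟩ else x
    have hg : ∀ x (h : x ≠ v), g x = f ⟨x, h⟩ := fun x h => dif_pos h
    have hgv : g v = v := dif_neg (by simp)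
    refine ⟨g, ⟨fun x => ?_, fun x hx => ?_⟩, hgv, fun x hx => ?_⟩
    · by_cases hx : x = v
      · subst hx; rw [hgv, hgv]
      · rw [hg x hx, hg _ (f ⟨x, hx⟩).2, hf.1]
    · by_cases hxv : x = v
      · exact absurd (hxv ▸ hgv) hx
      · rw [hg x hxv]
        exact hf.2 ⟨x, hxv⟩ (hne _)
    · rw [hg x hx]
      exact fun h => hne ⟨x, hx⟩ (Subtype.ext h)
  · right
    have hcard : Fintype.card {x // x ≠ v} = Fintype.card V - 1 := by simp
    obtain ⟨S, P, hP, hc⟩ := exists_isBarrier (G.comap ι) (by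
      rw [hcard]; exact Nat.Odd.sub_odd hodd odd_one) h
    have hvS : v ∉ S.map ι := by
      intro hv
      obtain ⟨x, -, hx⟩ := Finset.mem_map.1 hv
      exact x.2 hx
    have hmem : ∀ (D : Finset {x // x ≠ v}) x, x ∈ D.map ι ↔ ∃ h : x ≠ v, ⟨x, h⟩ ∈ D := by
      intro D x
      simp [ι]
    -- Adding `v` to the barrier of `G - v` lowers the surplus of blocks from two to one.
    refine ⟨insert v (S.map ι), P.image fun D => D.map ι, ⟨?_, ?_, ?_⟩,
      Finset.mem_insert_self _ _, ?_⟩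
    · intro E hE
      obtain ⟨D, hD, rfl⟩ := Finset.mem_image.1 hE
      refine ⟨Finset.disjoint_left.2 fun x hx hx' => ?_, fun x hx y hxy => ?_⟩
      · obtain ⟨hxv, hxD⟩ := (hmem D x).1 hx
        rcases Finset.mem_insert.1 hx' with rfl | hx'
        · exact hxv rfl
        · exact Finset.disjoint_left.1 (hP.closed D hD).1 hxD ((hmem S x).1 hx').2
      · obtain ⟨hxv, hxD⟩ := (hmem D x).1 hx
        rw [Finset.mem_insert, hmem, hmem]
        by_cases hy : y = v
        · exact Or.inr (Or.inl hy)
        · rcases (hP.closed D hD).2 ⟨x, hxv⟩ hxD ⟨y, hy⟩ hxy with h | h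
          · exact Or.inl ⟨hy, h⟩
          · exact Or.inr (Or.inr ⟨hy, h⟩)
    · intro E hE
      obtain ⟨D, hD, rfl⟩ := Finset.mem_image.1 hE
      rw [Finset.card_map]
      exact hP.odd D hD
    · intro E hE E' hE' hne
      obtain ⟨D, hD, rfl⟩ := Finset.mem_image.1 hE
      obtain ⟨D', hD', rfl⟩ := Finset.mem_image.1 hE'
      rw [Finset.disjoint_map]
      exact hP.disj D hD D' hD' fun h => hne (h ▸ rfl)
    · rw [Finset.card_insert_of_notMem hvS, Finset.card_map,
        Finset.card_image_of_injective _ (Finset.map_injective ι)]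
      omega

/-! ### Recognising spanning subgraphs from a list of vertices -/

lemma isSpannedBy_ofEdges {V : Type*} [Fintype V] {G : SimpleGraph V} {n : ℕ}
    (hV : Fintype.card V = n) {E : Finset (Sym2 (Fin n))} (v : Fin n → V)
    (hv : (List.ofFn v).Nodup) (h : ∀ e ∈ E, e.map v ∈ G.edgeSet) :
    IsSpannedBy G (ofEdges E) := by
  refine ⟨⟨v, fun {a b} hab => ?_⟩, ?_⟩
  · simp only [ofEdges, fromEdgeSet_adj, Finset.mem_coe] at hab
    simpa using h _ hab.1
  · exact (Fintype.bijective_iff_injective_and_card v).2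
      ⟨List.nodup_ofFn.1 hv, by rw [Fintype.card_fin, hV]⟩

lemma isSpannedBy_cycleGraph {V : Type*} [Fintype V] {G : SimpleGraph V} {n : ℕ}
    (hV : Fintype.card V = n + 2) (v : Fin (n + 2) → V)
    (hv : (List.ofFn v).Nodup) (h : ∀ i, G.Adj (v i) (v (i + 1))) :
    IsSpannedBy G (cycleGraph (n + 2)) := by
  refine ⟨⟨v, fun {a b} hab => ?_⟩, ?_⟩
  · rw [cycleGraph_adj] at hab
    rcases hab with hab | hab
    · rw [sub_eq_iff_eq_add'] at hab
      subst hab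
      exact (h b).symm
    · rw [sub_eq_iff_eq_add'] at hab
      subst hab
      exact h a
  · exact (Fintype.bijective_iff_injective_and_card v).2
      ⟨List.nodup_ofFn.1 hv, by rw [Fintype.card_fin, hV]⟩

/-! ### Ear decompositions of factor-critical graphs on seven vertices -/

section Seven

variable {V : Type*} [Fintype V] {G : SimpleGraph V}

lemma isSpannedBy_cycleGraph_seven (hV : Fintype.card V = 7) {a b c d e f g : V}
    (hn : [a, b, c, d, e, f, g].Nodup) (h1 : G.Adj a b) (h2 : G.Adj b c) (h3 : G.Adj c d)
    (h4 : G.Adj d e) (h5 : G.Adj e f) (h6 : G.Adj f g) (h7 : G.Adj g a) :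
    IsSpannedBy G (cycleGraph 7) :=
  isSpannedBy_cycleGraph hV ![a, b, c, d, e, f, g] (by simpa using hn)
    (by intro i; fin_cases i <;> assumption)

lemma isSpannedBy_trianglePentagon (hV : Fintype.card V = 7) {a b c d e f g : V}
    (hn : [a, b, c, d, e, f, g].Nodup) (h1 : G.Adj a b) (h2 : G.Adj b c) (h3 : G.Adj a c)
    (h4 : G.Adj a d) (h5 : G.Adj d e) (h6 : G.Adj e f) (h7 : G.Adj f g) (h8 : G.Adj g a) :
    IsSpannedBy G trianglePentagon :=
  isSpannedBy_ofEdges hV ![a, b, c, d, e, f, g] (by simpa using hn) (by simp [*])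

lemma isSpannedBy_twoPentagons (hV : Fintype.card V = 7) {a b c d e f g : V}
    (hn : [a, b, c, d, e, f, g].Nodup) (h1 : G.Adj a b) (h2 : G.Adj b c) (h3 : G.Adj c d)
    (h4 : G.Adj d e) (h5 : G.Adj e a) (h6 : G.Adj c f) (h7 : G.Adj f g) (h8 : G.Adj g a) :
    IsSpannedBy G twoPentagons :=
  isSpannedBy_ofEdges hV ![a, b, c, d, e, f, g] (by simpa using hn) (by simp [*])

lemma isSpannedBy_threeTriangles (hV : Fintype.card V = 7) {a b c d e f g : V}
    (hn : [a, b, c, d, e, f, g].Nodup) (h1 : G.Adj a b) (h2 : G.Adj a c) (h3 : G.Adj b c)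
    (h4 : G.Adj a d) (h5 : G.Adj a e) (h6 : G.Adj d e) (h7 : G.Adj a f) (h8 : G.Adj a g)
    (h9 : G.Adj f g) : IsSpannedBy G threeTriangles :=
  isSpannedBy_ofEdges hV ![a, b, c, d, e, f, g] (by simpa using hn) (by simp [*])

lemma isSpannedBy_trianglesWithPath (hV : Fintype.card V = 7) {a b c d e f g : V}
    (hn : [a, b, c, d, e, f, g].Nodup) (h1 : G.Adj a b) (h2 : G.Adj a c) (h3 : G.Adj b c)
    (h4 : G.Adj c d) (h5 : G.Adj d e) (h6 : G.Adj e f) (h7 : G.Adj e g) (h8 : G.Adj f g) :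
    IsSpannedBy G trianglesWithPath :=
  isSpannedBy_ofEdges hV ![a, b, c, d, e, f, g] (by simpa using hn) (by simp [*])

/-- Every vertex is the only one missed by some matching. -/
def IsFactorCritical (G : SimpleGraph V) : Prop :=
  ∀ v, ∃ f, IsMatchInv G f ∧ f v = v ∧ ∀ x, x ≠ v → f x ≠ x

/-- `m` matches the vertices outside `H` among themselves. -/
def MatchesOutside (G : SimpleGraph V) (H : Finset V) (m : V → V) : Prop :=
  (∀ x, m (m x) = x) ∧ ∀ x, x ∉ H → G.Adj x (m x) ∧ m x ∉ H

/-- The five spanning types of connected graphs with seven vertices. -/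
def IsSevenType (G : SimpleGraph V) : Prop :=
  IsSpannedBy G (cycleGraph 7) ∨ IsSpannedBy G trianglePentagon ∨ IsSpannedBy G twoPentagons ∨
    IsSpannedBy G threeTriangles ∨ IsSpannedBy G trianglesWithPath

/-- The complement of `H` is even because `m` pairs it off. If no edge left it, a matching missing
only `x` would also pair off the complement without `x`. -/
lemma IsFactorCritical.exists_adj_outside (hG : IsFactorCritical G) {H : Finset V} {m : V → V}
    (hm : MatchesOutside G H m) (hne : ∃ x, x ∉ H) : ∃ h ∈ H, ∃ x, x ∉ H ∧ G.Adj h x := by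
  classical
  by_contra! hno
  obtain ⟨x, hx⟩ := hne
  obtain ⟨f, hf, hfx, hmove⟩ := hG x
  have h1 : Even (Hᶜ).card := even_card_of_invol _ m
    (fun y hy => by simpa using (hm.2 y (by simpa using hy)).2) (fun y _ => hm.1 y)
    (fun y hy => (hm.2 y (by simpa using hy)).1.ne.symm)
  have h2 : Even (Hᶜ.erase x).card := by
    refine even_card_of_invol _ f (fun y hy => ?_) (fun y _ => hf.1 y) fun y hy => ?_
    · obtain ⟨hyx, hy⟩ := Finset.mem_erase.1 hy
      refine Finset.mem_erase.2 ⟨fun h => ?_, ?_⟩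
      · rw [← h, hf.1] at hfx
        exact hyx (hfx.trans h)
      · rw [Finset.mem_compl] at hy ⊢
        exact fun h => hno _ h y hy (hf.2 y (hmove y hyx)).symm
    · exact hmove y (Finset.mem_erase.1 hy).1
  have h3 := Finset.card_erase_add_one (Finset.mem_compl.2 hx)
  rw [← h3] at h1
  exact Nat.not_odd_iff_even.2 h1 h2.add_one

/-- An ear with two, four or six new vertices. -/
lemma IsFactorCritical.exists_ear (hG : IsFactorCritical G) (hV : Fintype.card V = 7)
    {H : Finset V} {m : V → V} (hm : MatchesOutside G H m) (hne : ∃ x, x ∉ H) :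
    ∃ h ∈ H, ∃ h' ∈ H, ∃ x y, m x = y ∧ x ∉ H ∧ y ∉ H ∧ x ≠ y ∧ G.Adj h x ∧ G.Adj x y ∧
      (G.Adj y h' ∨ ∃ z w, m z = w ∧ z ∉ H ∧ w ∉ H ∧ [x, y, z, w].Nodup ∧ G.Adj y z ∧
        G.Adj z w ∧ (G.Adj w h' ∨ ∃ u t, u ∉ H ∧ t ∉ H ∧ [x, y, z, w, u, t].Nodup ∧
          G.Adj w u ∧ G.Adj u t ∧ G.Adj t h')) := by
  obtain ⟨h, hH, x, hx, hadj⟩ := hG.exists_adj_outside hm hne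
  -- The ear follows `m` and `f` alternately from `x`, starting with `m`, until an `f`-edge enters
  -- `H`. It uses up whole pairs of `m`, so it has an even number of new vertices.
  obtain ⟨f, hf, hfx, hmove⟩ := hG x
  have hff : ∀ a b, f a = f b → a = b := fun a b h => by rw [← hf.1 a, h, hf.1]
  have hmm : ∀ a b, m a = m b → a = b := fun a b h => by rw [← hm.1 a, h, hm.1]
  obtain ⟨hxy, hy⟩ := hm.2 x hx
  have hy' := hf.2 _ (hmove (m x) hxy.ne.symm)
  by_cases hfy : f (m x) ∈ H
  · exact ⟨h, hH, _, hfy, x, m x, rfl, hx, hy, hxy.ne, hadj, hxy, Or.inl hy'⟩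
  obtain ⟨hzw, hw⟩ := hm.2 _ hfy
  have hm1 := hm.1 x
  generalize hyd : m x = y at *
  -- The walk cannot return to `x`, the one vertex that `f` misses.
  have hzx : f y ≠ x := fun h => hxy.ne (by rw [← hfx, ← h, hf.1])
  have hm2 := hm.1 (f y)
  have hf1 := hf.1 y
  generalize hzd : f y = z at *
  generalize hwd : m z = w at *
  have hn4 : [x, y, z, w].Nodup := by
    have := hxy.ne; have := hy'.ne; have := hzw.ne
    simp only [List.nodup_cons, List.mem_cons, List.not_mem_nil, or_false, not_or,
      not_false_eq_true, List.nodup_nil, and_true]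
    grind
  have hwx : w ≠ x := by grind
  have hw' := hf.2 w (hmove w hwx)
  by_cases hfw : f w ∈ H
  · exact ⟨h, hH, _, hfw, x, y, hyd, hx, hy, hxy.ne, hadj, hxy,
      Or.inr ⟨z, w, hwd, hfy, hw, hn4, hy', hzw, Or.inl hw'⟩⟩
  obtain ⟨hut, ht⟩ := hm.2 _ hfw
  have hm3 := hm.1 (f w)
  have hf2 := hf.1 w
  generalize hud : f w = u at *
  generalize htd : m u = t at *
  have hux : u ≠ x := by grind
  have hn6 : [x, y, z, w, u, t].Nodup := by
    have := hxy.ne; have := hy'.ne; have := hzw.ne; have := hw'.ne; have := hut.ne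
    simp only [List.nodup_cons, List.mem_cons, List.not_mem_nil, or_false, not_or,
      not_false_eq_true, List.nodup_nil, and_true] at hn4 ⊢
    grind
  have htx : t ≠ x := by grind
  have ht' := hf.2 t (hmove t htx)
  -- Otherwise `f t` would be an eighth vertex.
  have hft : f t ∈ H := by
    by_contra hft
    have hf3 := hf.1 t
    have h8 : [h, x, y, z, w, u, t, f t].Nodup := by
      have := ht'.ne
      simp only [List.nodup_cons, List.mem_cons, List.not_mem_nil, or_false, not_or,
        not_false_eq_true, List.nodup_nil, and_true] at hn6 ⊢
      grind
    have := h8.length_le_card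
    simp at this
    omega
  exact ⟨h, hH, _, hft, x, y, hyd, hx, hy, hxy.ne, hadj, hxy,
      Or.inr ⟨z, w, hwd, hfy, hw, hn4, hy', hzw, Or.inr ⟨u, t, hfw, ht, hn6, hw', hut, ht'⟩⟩⟩

/-- The type depends on the distance of the ends of the ear along the pentagon: 0 gives a triangle
at `a`, 1 gives C_7, 2 gives a second pentagon sharing a path of length two. -/
lemma isSevenType_of_pentagon_of_ear (hV : Fintype.card V = 7) {a b c d e x y h' : V}
    (hn : [a, b, c, d, e, x, y].Nodup) (h1 : G.Adj a b) (h2 : G.Adj b c) (h3 : G.Adj c d)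
    (h4 : G.Adj d e) (h5 : G.Adj e a) (h6 : G.Adj a x) (h7 : G.Adj x y) (h8 : G.Adj y h')
    (hh : h' = a ∨ h' = b ∨ h' = c ∨ h' = d ∨ h' = e) : IsSevenType G := by
  rcases hh with rfl | rfl | rfl | rfl | rfl
  · exact Or.inr (Or.inl (isSpannedBy_trianglePentagon hV (a := h') (b := x) (c := y) (d := b)
      (e := c) (f := d) (g := e) (by grind only [List.nodup_cons, List.mem_cons,
            List.not_mem_nil, List.nodup_nil]) h6 h7 h8.symm h1 h2 h3 h4 h5))
  · exact Or.inl (isSpannedBy_cycleGraph_seven hV (a := a) (b := x) (c := y) (d := h') (e := c)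
      (f := d) (g := e) (by grind only [List.nodup_cons, List.mem_cons,
            List.not_mem_nil, List.nodup_nil]) h6 h7 h8 h2 h3 h4 h5)
  · exact Or.inr (Or.inr (Or.inl (isSpannedBy_twoPentagons hV (a := a) (b := b) (c := h') (d := d)
      (e := e) (f := y) (g := x) (by grind only [List.nodup_cons, List.mem_cons,
            List.not_mem_nil, List.nodup_nil]) h1 h2 h3 h4 h5 h8.symm h7.symm h6.symm)))
  · exact Or.inr (Or.inr (Or.inl (isSpannedBy_twoPentagons hV (a := a) (b := e) (c := h') (d := c)
      (e := b) (f := y) (g := x) (by grind only [List.nodup_cons, List.mem_cons,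
            List.not_mem_nil, List.nodup_nil]) h5.symm h4.symm h3.symm h2.symm h1.symm h8.symm
      h7.symm h6.symm)))
  · exact Or.inl (isSpannedBy_cycleGraph_seven hV (a := a) (b := x) (c := y) (d := h') (e := d)
      (f := c) (g := b) (by grind only [List.nodup_cons, List.mem_cons,
            List.not_mem_nil, List.nodup_nil]) h6 h7 h8 h4.symm h3.symm h2.symm h1.symm)

/-- Around a set of five vertices, an ear has exactly two new vertices. -/
lemma IsFactorCritical.exists_ear_of_five (hG : IsFactorCritical G) (hV : Fintype.card V = 7)
    {a b c d e : V} (hn : [a, b, c, d, e].Nodup) {m : V → V}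
    (hm1 : ∀ x, m (m x) = x) (hm2 : ∀ x, x ∉ [a, b, c, d, e] →
      G.Adj x (m x) ∧ m x ∉ [a, b, c, d, e]) :
    ∃ h ∈ [a, b, c, d, e], ∃ h' ∈ [a, b, c, d, e], ∃ x y, [a, b, c, d, e, x, y].Nodup ∧
      G.Adj h x ∧ G.Adj x y ∧ G.Adj y h' := by
  classical
  have hcard := hn.length_le_card
  obtain ⟨h, hh, h', hh', x, y, -, hx, hy, hxy, hhx, hxy', hy'⟩ :=
    hG.exists_ear hV (H := [a, b, c, d, e].toFinset) (m := m)
    ⟨hm1, fun x hx => by simpa using hm2 x (by simpa using hx)⟩ (by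
      by_contra! hall
      have h1 : (Finset.univ : Finset V) ⊆ [a, b, c, d, e].toFinset := fun x _ => hall x
      have h2 := (Finset.card_le_card h1).trans (List.toFinset_card_le _)
      rw [Finset.card_univ, hV] at h2
      simp at h2)
  rw [List.mem_toFinset] at hx hy hh hh'
  have hn7 : [a, b, c, d, e, x, y].Nodup := by grind only [List.nodup_cons, List.mem_cons,
            List.not_mem_nil, List.nodup_nil]
  rcases hy' with hy' | ⟨z, w, -, hz, hw, hn4, -⟩
  · exact ⟨h, hh, h', hh', x, y, hn7, hhx, hxy', hy'⟩
  · rw [List.mem_toFinset] at hz hw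
    have h8 : [a, b, c, d, e, x, y, z].Nodup := by grind only [List.nodup_cons, List.mem_cons,
            List.not_mem_nil, List.nodup_nil]
    have := h8.length_le_card
    simp at this
    omega

lemma IsFactorCritical.isSevenType_of_pentagon (hG : IsFactorCritical G)
    (hV : Fintype.card V = 7) {a b c d e : V} (hn : [a, b, c, d, e].Nodup) {m : V → V}
    (hm1 : ∀ x, m (m x) = x)
    (hm2 : ∀ x, x ∉ [a, b, c, d, e] → G.Adj x (m x) ∧ m x ∉ [a, b, c, d, e])
    (h1 : G.Adj a b) (h2 : G.Adj b c) (h3 : G.Adj c d) (h4 : G.Adj d e) (h5 : G.Adj e a) :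
    IsSevenType G := by
  obtain ⟨h, hh, h', hh', x, y, hn7, hhx, hxy, hy⟩ := hG.exists_ear_of_five hV hn hm1 hm2
  simp only [List.mem_cons, List.not_mem_nil, or_false] at hh hh'
  rcases hh with rfl | rfl | rfl | rfl | rfl
  · exact isSevenType_of_pentagon_of_ear hV hn7 h1 h2 h3 h4 h5 hhx hxy hy hh'
  · exact isSevenType_of_pentagon_of_ear hV (a := h) (b := c) (c := d) (d := e) (e := a)
      (by grind only [List.nodup_cons, List.mem_cons,
            List.not_mem_nil, List.nodup_nil])
      h2 h3 h4 h5 h1 hhx hxy hy (by tauto)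
  · exact isSevenType_of_pentagon_of_ear hV (a := h) (b := d) (c := e) (d := a) (e := b)
      (by grind only [List.nodup_cons, List.mem_cons,
            List.not_mem_nil, List.nodup_nil])
      h3 h4 h5 h1 h2 hhx hxy hy (by tauto)
  · exact isSevenType_of_pentagon_of_ear hV (a := h) (b := e) (c := a) (d := b) (e := c)
      (by grind only [List.nodup_cons, List.mem_cons,
            List.not_mem_nil, List.nodup_nil])
      h4 h5 h1 h2 h3 hhx hxy hy (by tauto)
  · exact isSevenType_of_pentagon_of_ear hV (a := h) (b := a) (c := b) (d := c) (e := d)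
      (by grind only [List.nodup_cons, List.mem_cons,
            List.not_mem_nil, List.nodup_nil])
      h5 h1 h2 h3 h4 hhx hxy hy (by tauto)

/-- An ear returning to the centre is a third triangle; otherwise it forms a pentagon with the two
edges of the wing it reaches, and the other wing is the triangle. -/
lemma isSevenType_of_bowtie_of_center_ear (hV : Fintype.card V = 7) {c a b d e x y h' : V}
    (hn : [c, a, b, d, e, x, y].Nodup) (h1 : G.Adj c a) (h2 : G.Adj c b) (h3 : G.Adj a b)
    (h4 : G.Adj c d) (h5 : G.Adj c e) (h6 : G.Adj d e) (h7 : G.Adj c x) (h8 : G.Adj x y)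
    (h9 : G.Adj y h') (hh : h' = c ∨ h' = a ∨ h' = b ∨ h' = d ∨ h' = e) : IsSevenType G := by
  rcases hh with rfl | rfl | rfl | rfl | rfl
  · exact Or.inr (Or.inr (Or.inr (Or.inl (isSpannedBy_threeTriangles hV hn h1 h2 h3 h4 h5 h6 h7
      h9.symm h8))))
  · exact Or.inr (Or.inl (isSpannedBy_trianglePentagon hV (a := c) (b := d) (c := e) (d := x)
      (e := y) (f := h') (g := b) (by grind only [List.nodup_cons, List.mem_cons,
            List.not_mem_nil, List.nodup_nil]) h4 h6 h5 h7 h8 h9 h3 h2.symm))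
  · exact Or.inr (Or.inl (isSpannedBy_trianglePentagon hV (a := c) (b := d) (c := e) (d := x)
      (e := y) (f := h') (g := a) (by grind only [List.nodup_cons, List.mem_cons,
            List.not_mem_nil, List.nodup_nil]) h4 h6 h5 h7 h8 h9 h3.symm h1.symm))
  · exact Or.inr (Or.inl (isSpannedBy_trianglePentagon hV (a := c) (b := a) (c := b) (d := x)
      (e := y) (f := h') (g := e) (by grind only [List.nodup_cons, List.mem_cons,
            List.not_mem_nil, List.nodup_nil]) h1 h3 h2 h7 h8 h9 h6 h5.symm))
  · exact Or.inr (Or.inl (isSpannedBy_trianglePentagon hV (a := c) (b := a) (c := b) (d := x)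
      (e := y) (f := h') (g := d) (by grind only [List.nodup_cons, List.mem_cons,
            List.not_mem_nil, List.nodup_nil]) h1 h3 h2 h7 h8 h9 h6.symm h4.symm))

/-- An ear ending at `c` or `b` makes a pentagon with the wing `a`, `b`; one ending in the opposite
wing closes to C_7; one returning to `a` is a triangle joined to the opposite wing through `b`. -/
lemma isSevenType_of_bowtie_of_wing_ear (hV : Fintype.card V = 7) {c a b d e x y h' : V}
    (hn : [c, a, b, d, e, x, y].Nodup) (h1 : G.Adj c a) (h2 : G.Adj c b) (h3 : G.Adj a b)
    (h4 : G.Adj c d) (h5 : G.Adj c e) (h6 : G.Adj d e) (h7 : G.Adj a x) (h8 : G.Adj x y)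
    (h9 : G.Adj y h') (hh : h' = c ∨ h' = a ∨ h' = b ∨ h' = d ∨ h' = e) : IsSevenType G := by
  rcases hh with rfl | rfl | rfl | rfl | rfl
  · exact Or.inr (Or.inl (isSpannedBy_trianglePentagon hV (a := h') (b := d) (c := e) (d := b)
      (e := a) (f := x) (g := y) (by grind only [List.nodup_cons, List.mem_cons,
            List.not_mem_nil, List.nodup_nil]) h4 h6 h5 h2 h3.symm h7 h8 h9))
  · exact Or.inr (Or.inr (Or.inr (Or.inr (isSpannedBy_trianglesWithPath hV (a := x) (b := y)
      (c := h') (d := b) (e := c) (f := d) (g := e) (by grind only [List.nodup_cons, List.mem_cons,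
            List.not_mem_nil, List.nodup_nil]) h8 h7.symm h9 h3 h2.symm h4 h5 h6))))
  · exact Or.inr (Or.inl (isSpannedBy_trianglePentagon hV (a := c) (b := d) (c := e) (d := a)
      (e := x) (f := y) (g := h') (by grind only [List.nodup_cons, List.mem_cons,
            List.not_mem_nil, List.nodup_nil]) h4 h6 h5 h1 h7 h8 h9 h2.symm))
  · exact Or.inl (isSpannedBy_cycleGraph_seven hV (a := a) (b := x) (c := y) (d := h') (e := e)
      (f := c) (g := b) (by grind only [List.nodup_cons, List.mem_cons,
            List.not_mem_nil, List.nodup_nil]) h7 h8 h9 h6 h5.symm h2 h3.symm)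
  · exact Or.inl (isSpannedBy_cycleGraph_seven hV (a := a) (b := x) (c := y) (d := h') (e := d)
      (f := c) (g := b) (by grind only [List.nodup_cons, List.mem_cons,
            List.not_mem_nil, List.nodup_nil]) h7 h8 h9 h6.symm h4.symm h2 h3.symm)

lemma IsFactorCritical.isSevenType_of_bowtie (hG : IsFactorCritical G)
    (hV : Fintype.card V = 7) {c a b d e : V} (hn : [c, a, b, d, e].Nodup) {m : V → V}
    (hm1 : ∀ x, m (m x) = x)
    (hm2 : ∀ x, x ∉ [c, a, b, d, e] → G.Adj x (m x) ∧ m x ∉ [c, a, b, d, e])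
    (h1 : G.Adj c a) (h2 : G.Adj c b) (h3 : G.Adj a b) (h4 : G.Adj c d) (h5 : G.Adj c e)
    (h6 : G.Adj d e) : IsSevenType G := by
  obtain ⟨h, hh, h', hh', x, y, hn7, hhx, hxy, hy⟩ := hG.exists_ear_of_five hV hn hm1 hm2
  simp only [List.mem_cons, List.not_mem_nil, or_false] at hh hh'
  rcases hh with rfl | rfl | rfl | rfl | rfl
  · exact isSevenType_of_bowtie_of_center_ear hV hn7 h1 h2 h3 h4 h5 h6 hhx hxy hy hh'
  · exact isSevenType_of_bowtie_of_wing_ear hV hn7 h1 h2 h3 h4 h5 h6 hhx hxy hy hh'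
  · exact isSevenType_of_bowtie_of_wing_ear hV (c := c) (a := h) (b := a) (d := d) (e := e)
      (by grind only [List.nodup_cons, List.mem_cons,
            List.not_mem_nil, List.nodup_nil]) h2 h1 h3.symm h4 h5 h6 hhx hxy hy (by tauto)
  · exact isSevenType_of_bowtie_of_wing_ear hV (c := c) (a := h) (b := e) (d := a) (e := b)
      (by grind only [List.nodup_cons, List.mem_cons,
            List.not_mem_nil, List.nodup_nil]) h4 h5 h6 h1 h2 h3 hhx hxy hy (by tauto)
  · exact isSevenType_of_bowtie_of_wing_ear hV (c := c) (a := h) (b := d) (d := a) (e := b)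
      (by grind only [List.nodup_cons, List.mem_cons,
            List.not_mem_nil, List.nodup_nil]) h5 h4 h6.symm h1 h2 h3 hhx hxy hy (by tauto)

/-- A triangle with an ear of two new vertices starting at its first vertex. -/
lemma IsFactorCritical.isSevenType_of_triangle_of_ear (hG : IsFactorCritical G)
    (hV : Fintype.card V = 7) {a b c x y h' : V} (hn : [a, b, c, x, y].Nodup) {m : V → V}
    (hm1 : ∀ x, m (m x) = x) (hm2 : ∀ x, x ∉ [a, b, c] → G.Adj x (m x) ∧ m x ∉ [a, b, c])
    (hmx : m x = y) (h1 : G.Adj a b) (h2 : G.Adj a c) (h3 : G.Adj b c) (h4 : G.Adj a x)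
    (h5 : G.Adj x y) (h6 : G.Adj y h') (hh : h' = a ∨ h' = b ∨ h' = c) : IsSevenType G := by
  -- Since `m` exchanges `x` and `y`, it still matches the vertices outside the enlarged set.
  have hm3 : ∀ z, z ∉ [a, b, c, x, y] → G.Adj z (m z) ∧ m z ∉ [a, b, c, x, y] := by
    intro z hz
    have hz' := hm2 z (by grind)
    have := hm1 z
    have := hm1 x
    exact ⟨hz'.1, by grind⟩
  rcases hh with rfl | rfl | rfl
  · exact hG.isSevenType_of_bowtie hV hn hm1 hm3 h1 h2 h3 h4 h6.symm h5
  · exact hG.isSevenType_of_pentagon hV (a := a) (b := x) (c := y) (d := h') (e := c)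
      (by grind only [List.nodup_cons, List.mem_cons,
            List.not_mem_nil, List.nodup_nil])
      hm1 (by grind only [List.nodup_cons, List.mem_cons,
            List.not_mem_nil, List.nodup_nil]) h4 h5 h6 h3 h2.symm
  · exact hG.isSevenType_of_pentagon hV (a := a) (b := x) (c := y) (d := h') (e := b)
      (by grind only [List.nodup_cons, List.mem_cons,
            List.not_mem_nil, List.nodup_nil])
      hm1 (by grind only [List.nodup_cons, List.mem_cons,
            List.not_mem_nil, List.nodup_nil]) h4 h5 h6 h3.symm h1.symm

lemma isSevenType_of_triangle_of_long_ear (hV : Fintype.card V = 7) {a b c x y z w h' : V}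
    (hn : [a, b, c, x, y, z, w].Nodup) (h1 : G.Adj a b) (h2 : G.Adj a c) (h3 : G.Adj b c)
    (h4 : G.Adj a x) (h5 : G.Adj x y) (h6 : G.Adj y z) (h7 : G.Adj z w) (h8 : G.Adj w h')
    (hh : h' = a ∨ h' = b ∨ h' = c) : IsSevenType G := by
  rcases hh with rfl | rfl | rfl
  · exact Or.inr (Or.inl (isSpannedBy_trianglePentagon hV hn h1 h3 h2 h4 h5 h6 h7 h8))
  · exact Or.inl (isSpannedBy_cycleGraph_seven hV (a := a) (b := x) (c := y) (d := z) (e := w)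
      (f := h') (g := c) (by grind only [List.nodup_cons, List.mem_cons,
            List.not_mem_nil, List.nodup_nil]) h4 h5 h6 h7 h8 h3 h2.symm)
  · exact Or.inl (isSpannedBy_cycleGraph_seven hV (a := a) (b := x) (c := y) (d := z) (e := w)
      (f := h') (g := b) (by grind only [List.nodup_cons, List.mem_cons,
            List.not_mem_nil, List.nodup_nil]) h4 h5 h6 h7 h8 h3.symm h1.symm)

lemma IsFactorCritical.isSevenType_of_triangle (hG : IsFactorCritical G)
    (hV : Fintype.card V = 7) {a b c : V} (hn : [a, b, c].Nodup) {m : V → V}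
    (hm1 : ∀ x, m (m x) = x) (hm2 : ∀ x, x ∉ [a, b, c] → G.Adj x (m x) ∧ m x ∉ [a, b, c])
    (h1 : G.Adj a b) (h2 : G.Adj a c) (h3 : G.Adj b c) : IsSevenType G := by
  classical
  obtain ⟨h, hh, h', hh', x, y, hmx, hx, hy, hxy, hhx, hxy', hy'⟩ :=
    hG.exists_ear hV (H := [a, b, c].toFinset) (m := m)
    ⟨hm1, fun x hx => by simpa using hm2 x (by simpa using hx)⟩ (by
      by_contra! hall
      have h1 : (Finset.univ : Finset V) ⊆ [a, b, c].toFinset := fun x _ => hall x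
      have h2 := (Finset.card_le_card h1).trans (List.toFinset_card_le _)
      rw [Finset.card_univ, hV] at h2
      simp at h2)
  rw [List.mem_toFinset] at hx hy hh hh'
  simp only [List.mem_cons, List.not_mem_nil, or_false] at hh hh'
  have hn5 : [a, b, c, x, y].Nodup := by grind only [List.nodup_cons, List.mem_cons,
            List.not_mem_nil, List.nodup_nil]
  rcases hy' with hy' | ⟨z, w, -, hz, hw, hn4, hyz, hzw, hwh⟩
  · rcases hh with rfl | rfl | rfl
    · exact hG.isSevenType_of_triangle_of_ear hV hn5 hm1 hm2 hmx h1 h2 h3 hhx hxy' hy' hh'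
    · exact hG.isSevenType_of_triangle_of_ear hV (a := h) (b := a) (c := c)
        (by grind only [List.nodup_cons, List.mem_cons,
            List.not_mem_nil, List.nodup_nil]) hm1
        (by grind only [List.nodup_cons, List.mem_cons,
            List.not_mem_nil, List.nodup_nil]) hmx h1.symm h3 h2 hhx hxy' hy' (by tauto)
    · exact hG.isSevenType_of_triangle_of_ear hV (a := h) (b := a) (c := b)
        (by grind only [List.nodup_cons, List.mem_cons,
            List.not_mem_nil, List.nodup_nil]) hm1
        (by grind only [List.nodup_cons, List.mem_cons,
            List.not_mem_nil, List.nodup_nil]) hmx h2.symm h3.symm h1 hhx hxy' hy' (by tauto)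
  · rw [List.mem_toFinset] at hz hw
    have hn7 : [a, b, c, x, y, z, w].Nodup := by grind only [List.nodup_cons, List.mem_cons,
            List.not_mem_nil, List.nodup_nil]
    rcases hwh with hwh | ⟨u, t, hu, ht, hn6, -⟩
    · rcases hh with rfl | rfl | rfl
      · exact isSevenType_of_triangle_of_long_ear hV hn7 h1 h2 h3 hhx hxy' hyz hzw hwh hh'
      · exact isSevenType_of_triangle_of_long_ear hV (a := h) (b := a) (c := c)
          (by grind only [List.nodup_cons, List.mem_cons,
            List.not_mem_nil, List.nodup_nil])
          h1.symm h3 h2 hhx hxy' hyz hzw hwh (by tauto)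
      · exact isSevenType_of_triangle_of_long_ear hV (a := h) (b := a) (c := b)
          (by grind only [List.nodup_cons, List.mem_cons,
            List.not_mem_nil, List.nodup_nil])
          h2.symm h3.symm h1 hhx hxy' hyz hzw hwh (by tauto)
    · rw [List.mem_toFinset] at hu ht
      have h8 : [a, b, c, x, y, z, w, u].Nodup := by grind only [List.nodup_cons, List.mem_cons,
            List.not_mem_nil, List.nodup_nil]
      have := h8.length_le_card
      simp at this
      omega

/-- Ear decomposition of factor-critical graphs with seven vertices. -/
theorem IsFactorCritical.isSevenType (hG : IsFactorCritical G) (hV : Fintype.card V = 7) :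
    IsSevenType G := by
  classical
  have : Nontrivial V := Fintype.one_lt_card_iff_nontrivial.1 (by omega)
  obtain ⟨r, s, hrs⟩ := exists_pair_ne V
  obtain ⟨m, hm, hmr, hmove⟩ := hG r
  have hm2 : ∀ x, x ≠ r → G.Adj x (m x) ∧ m x ≠ r := fun x hx =>
    ⟨hm.2 x (hmove x hx), fun h => hx (by rw [← hm.1 x, h, hmr])⟩
  -- Both ends of the first ear are `r`, so it is an odd cycle of length three, five or seven.
  obtain ⟨h, hh, h', hh', x, y, hmx, hx, hy, hxy, hhx, hxy', hy'⟩ :=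
    hG.exists_ear hV (H := {r}) (m := m)
    ⟨hm.1, fun x hx => by simpa using hm2 x (by simpa using hx)⟩ ⟨s, by simpa using hrs.symm⟩
  rw [Finset.mem_singleton] at hx hy hh hh'
  subst hh hh'
  have hmy := hm.1 x
  have hm1 := hm.1
  rcases hy' with hy' | ⟨z, w, hmz, hz, hw, hn4, hyz, hzw, hwh⟩
  · refine hG.isSevenType_of_triangle hV (a := h') (b := x) (c := y)
      (by grind only [List.nodup_cons, List.mem_cons,
            List.not_mem_nil, List.nodup_nil]) hm.1
      (fun z hz => ⟨(hm2 z (by grind)).1, ?_⟩) hhx hy'.symm hxy'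
    have := hm.1 z
    have := (hm2 z (by grind)).2
    grind
  rw [Finset.mem_singleton] at hz hw
  rcases hwh with hwh | ⟨u, t, hu, ht, hn6, hwu, hut, hth⟩
  · refine hG.isSevenType_of_pentagon hV (a := h') (b := x) (c := y) (d := z) (e := w) (by
      simp only [List.nodup_cons, List.mem_cons, List.not_mem_nil, or_false, not_or] at *
      grind)
      hm.1 (fun z hz => ⟨(hm2 z (by grind)).1, ?_⟩) hhx hxy' hyz hzw hwh
    have := hm.1 z
    have := (hm2 z (by grind)).2
    grind
  · rw [Finset.mem_singleton] at hu ht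
    exact Or.inl (isSpannedBy_cycleGraph_seven hV (a := h') (b := x) (c := y) (d := z) (e := w)
      (f := u) (g := t) (by
      simp only [List.nodup_cons, List.mem_cons, List.not_mem_nil, or_false, not_or] at *
      grind) hhx hxy' hyz hzw hwu hut hth)

end Seven

/-! ### Five and six vertices: complement triangle-free of maximum degree two -/

section Dense

variable {V : Type*} [Fintype V] {G : SimpleGraph V}

lemma exists_notMem_list (l : List V) (h : l.length < Fintype.card V) : ∃ x, x ∉ l := by
  classical
  by_contra! hall
  have h1 : (Finset.univ : Finset V) ⊆ l.toFinset := fun x _ => by simpa using hall x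
  have h2 := (Finset.card_le_card h1).trans (List.toFinset_card_le _)
  rw [Finset.card_univ] at h2
  omega

/-- Either some vertex has two non-neighbours, or the complement is a matching; in both cases the
vertices can be labelled so that `a` is adjacent to all but `b`, `c`, and `b`, `c` are adjacent. -/
lemma exists_labelling (hV : 5 ≤ Fintype.card V)
    (hd : ∀ a b c d, [a, b, c, d].Nodup → G.Adj a b ∨ G.Adj a c ∨ G.Adj a d)
    (ht : ∀ a b c, [a, b, c].Nodup → G.Adj a b ∨ G.Adj b c ∨ G.Adj a c) :
    ∃ a b c, [a, b, c].Nodup ∧ G.Adj b c ∧ (∀ x, x ∉ [a, b, c] → G.Adj a x) ∧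
      (∀ x y, [a, b, c, x, y].Nodup → (G.Adj b x ∨ G.Adj b y) ∧ (G.Adj c x ∨ G.Adj c y)) := by
  by_cases hA : ∃ a b c, [a, b, c].Nodup ∧ ¬ G.Adj a b ∧ ¬ G.Adj a c
  · obtain ⟨a, b, c, hn, hab, hac⟩ := hA
    -- `b` and `c` already miss `a`, so each misses at most one further vertex.
    refine ⟨a, b, c, hn, ?_, fun x hx => ?_, fun x y hxy => ⟨?_, ?_⟩⟩
    · have := ht a b c hn
      tauto
    · have := hd a b c x (by clear * - hn hx; grind only [List.nodup_cons, List.mem_cons,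
            List.not_mem_nil, List.nodup_nil])
      tauto
    · have := hd b a x y (by clear * - hxy; grind only [List.nodup_cons, List.mem_cons,
            List.not_mem_nil, List.nodup_nil])
      rw [G.adj_comm b a] at this
      tauto
    · have := hd c a x y (by clear * - hxy; grind only [List.nodup_cons, List.mem_cons,
            List.not_mem_nil, List.nodup_nil])
      rw [G.adj_comm c a] at this
      tauto
  -- Here every vertex has at most one non-neighbour; `b` is that of `a` if it exists, and `c` is
  -- any neighbour of `b` other than `a`.
  · push Not at hA
    obtain ⟨a, -⟩ := exists_notMem_list ([] : List V) (by simp; omega)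
    obtain ⟨b, hb, hab⟩ : ∃ b, a ≠ b ∧ ∀ x, x ∉ [a, b] → G.Adj a x := by
      by_cases h : ∃ b, a ≠ b ∧ ¬ G.Adj a b
      · obtain ⟨b, hb, hn⟩ := h
        exact ⟨b, hb, fun x hx => hA a b x
            (by clear * - hb hx; grind only [List.nodup_cons, List.mem_cons,
            List.not_mem_nil, List.nodup_nil]) hn⟩
      · push Not at h
        obtain ⟨b, hb⟩ := exists_notMem_list [a] (by simp; omega)
        exact ⟨b, by grind, fun x hx => h x
            (by clear * - hx hb; grind only [List.nodup_cons, List.mem_cons,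
            List.not_mem_nil, List.nodup_nil])⟩
    obtain ⟨x, hx⟩ := exists_notMem_list [a, b] (by simp; omega)
    obtain ⟨y, hy⟩ := exists_notMem_list [a, b, x] (by simp; omega)
    obtain ⟨c, hc, hbc⟩ : ∃ c, c ∉ [a, b] ∧ G.Adj b c := by
      by_cases h : G.Adj b x
      · exact ⟨x, hx, h⟩
      · exact ⟨y, by grind, hA b x y
          (by clear * - hx hy; grind only [List.nodup_cons, List.mem_cons,
            List.not_mem_nil, List.nodup_nil]) h⟩
    refine ⟨a, b, c, by grind, hbc, fun x hx => hab x
        (by grind only [List.nodup_cons, List.mem_cons,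
            List.not_mem_nil, List.nodup_nil]), fun x y hxy => ⟨?_, ?_⟩⟩
    · exact or_iff_not_imp_left.2 (hA b x y
        (by clear * - hxy; grind only [List.nodup_cons, List.mem_cons,
            List.not_mem_nil, List.nodup_nil]))
    · exact or_iff_not_imp_left.2 (hA c x y
        (by clear * - hxy; grind only [List.nodup_cons, List.mem_cons,
            List.not_mem_nil, List.nodup_nil]))

lemma isSpannedBy_cycleGraph_five (hV : Fintype.card V = 5) {a b c d e : V}
    (hn : [a, b, c, d, e].Nodup) (h1 : G.Adj a b) (h2 : G.Adj b c) (h3 : G.Adj c d)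
    (h4 : G.Adj d e) (h5 : G.Adj e a) : IsSpannedBy G (cycleGraph 5) :=
  isSpannedBy_cycleGraph hV ![a, b, c, d, e] (by simpa using hn)
    (by intro i; fin_cases i <;> assumption)

lemma isSpannedBy_bowtie (hV : Fintype.card V = 5) {a b c d e : V}
    (hn : [a, b, c, d, e].Nodup) (h1 : G.Adj a b) (h2 : G.Adj a c) (h3 : G.Adj b c)
    (h4 : G.Adj a d) (h5 : G.Adj a e) (h6 : G.Adj d e) : IsSpannedBy G bowtie :=
  isSpannedBy_ofEdges hV ![a, b, c, d, e] (by simpa using hn) (by simp [*])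

/-- A graph of order five whose complement is triangle-free with maximum degree at most two. -/
lemma isSpannedBy_of_card_five (hV : Fintype.card V = 5)
    (hd : ∀ a b c d, [a, b, c, d].Nodup → G.Adj a b ∨ G.Adj a c ∨ G.Adj a d)
    (ht : ∀ a b c, [a, b, c].Nodup → G.Adj a b ∨ G.Adj b c ∨ G.Adj a c) :
    IsSpannedBy G (cycleGraph 5) ∨ IsSpannedBy G bowtie := by
  obtain ⟨a, b, c, hn3, hbc, ha, hbc'⟩ := exists_labelling hV.ge hd ht
  obtain ⟨d, hd'⟩ := exists_notMem_list [a, b, c] (by simp; omega)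
  obtain ⟨e, he'⟩ := exists_notMem_list [a, b, c, d] (by simp; omega)
  have hn : [a, b, c, d, e].Nodup := by
    clear * - hn3 hd' he'
    grind only [List.nodup_cons, List.mem_cons, List.not_mem_nil, List.nodup_nil]
  have had := ha d hd'
  have hae := ha e (by clear * - hn; grind only [List.nodup_cons, List.mem_cons,
            List.not_mem_nil, List.nodup_nil])
  obtain ⟨hb, hc⟩ := hbc' d e hn
  by_cases h1 : G.Adj b e ∧ G.Adj c d
  · exact Or.inl (isSpannedBy_cycleGraph_five hV (a := a) (b := d) (c := c) (d := b) (e := e)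
      (by clear * - hn; grind only [List.nodup_cons, List.mem_cons,
            List.not_mem_nil, List.nodup_nil]) had h1.2.symm hbc.symm h1.1 hae.symm)
  by_cases h2 : G.Adj b d ∧ G.Adj c e
  · exact Or.inl (isSpannedBy_cycleGraph_five hV (a := a) (b := d) (c := b) (d := c) (e := e)
      (by clear * - hn; grind only [List.nodup_cons, List.mem_cons,
            List.not_mem_nil, List.nodup_nil]) had h2.1.symm hbc h2.2 hae.symm)
  right
  -- With both pentagons excluded, `b` and `c` miss the same vertex of `d`, `e`; the other one is
  -- the centre of the bowtie.
  by_cases hbe : G.Adj b e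
  · have hcd : ¬ G.Adj c d := by tauto
    have hce : G.Adj c e := by tauto
    have hbd : ¬ G.Adj b d := by tauto
    have hde : G.Adj d e := by
      have := hd d b c e (by clear * - hn; grind only [List.nodup_cons, List.mem_cons,
            List.not_mem_nil, List.nodup_nil])
      rw [G.adj_comm d b, G.adj_comm d c] at this
      tauto
    exact isSpannedBy_bowtie hV (a := e) (b := a) (c := d) (d := b) (e := c)
        (by clear * - hn; grind only [List.nodup_cons, List.mem_cons,
            List.not_mem_nil, List.nodup_nil])
      hae.symm hde.symm had hbe.symm hce.symm hbc
  · have hbd : G.Adj b d := by tauto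
    have hce : ¬ G.Adj c e := by tauto
    have hcd : G.Adj c d := by tauto
    have hde : G.Adj d e := by
      have := hd e b c d (by clear * - hn; grind only [List.nodup_cons, List.mem_cons,
            List.not_mem_nil, List.nodup_nil])
      rw [G.adj_comm e b, G.adj_comm e c, G.adj_comm e d] at this
      tauto
    exact isSpannedBy_bowtie hV (a := d) (b := a) (c := e) (d := b) (e := c)
        (by clear * - hn; grind only [List.nodup_cons, List.mem_cons,
            List.not_mem_nil, List.nodup_nil])
      had.symm hde hae hbd.symm hcd.symm hbc

lemma isSpannedBy_coneOnPentagon (hV : Fintype.card V = 6) {a b c d e f : V}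
    (hn : [a, b, c, d, e, f].Nodup) (h1 : G.Adj a b) (h2 : G.Adj b c) (h3 : G.Adj c d)
    (h4 : G.Adj d e) (h5 : G.Adj e a) (h6 : G.Adj f a) (h7 : G.Adj f b) (h8 : G.Adj f c)
    (h9 : G.Adj f d) (h10 : G.Adj f e) : IsSpannedBy G coneOnPentagon :=
  isSpannedBy_ofEdges hV ![a, b, c, d, e, f] (by simpa using hn) (by simp [*])

lemma isSpannedBy_fourTriangles (hV : Fintype.card V = 6) {a b c d e f : V}
    (hn : [a, b, c, d, e, f].Nodup) (h1 : G.Adj c d) (h2 : G.Adj e f) (h3 : G.Adj a c)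
    (h4 : G.Adj a d) (h5 : G.Adj a e) (h6 : G.Adj a f) (h7 : G.Adj b c) (h8 : G.Adj b d)
    (h9 : G.Adj b e) (h10 : G.Adj b f) : IsSpannedBy G fourTriangles :=
  isSpannedBy_ofEdges hV ![a, b, c, d, e, f] (by simpa using hn) (by simp [*])

lemma isSpannedBy_triangularPrism (hV : Fintype.card V = 6) {a b c d e f : V}
    (hn : [a, b, c, d, e, f].Nodup) (h1 : G.Adj a b) (h2 : G.Adj b c) (h3 : G.Adj a c)
    (h4 : G.Adj d e) (h5 : G.Adj e f) (h6 : G.Adj d f) (h7 : G.Adj a d) (h8 : G.Adj b e)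
    (h9 : G.Adj c f) : IsSpannedBy G triangularPrism :=
  isSpannedBy_ofEdges hV ![a, b, c, d, e, f] (by simpa using hn) (by simp [*])

/-- The three spanning types of graphs with six vertices. -/
def IsSixType (G : SimpleGraph V) : Prop :=
  IsSpannedBy G coneOnPentagon ∨ IsSpannedBy G fourTriangles ∨ IsSpannedBy G triangularPrism

/-- Some edge among `x`, `y`, `z` exists, and each of the three possibilities completes a prism. -/
lemma isSixType_of_labelling_of_adj (hV : Fintype.card V = 6)
    (ht : ∀ a b c, [a, b, c].Nodup → G.Adj a b ∨ G.Adj b c ∨ G.Adj a c)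
    {a b c x y z : V} (hn : [a, b, c, x, y, z].Nodup) (hax : G.Adj a x) (hay : G.Adj a y)
    (haz : G.Adj a z) (hbc : G.Adj b c) (hby : G.Adj b y) (hbz : G.Adj b z) (hcx : G.Adj c x)
    (hcz : G.Adj c z) (hbx : G.Adj b x)
    (hd : ∀ a b c d, [a, b, c, d].Nodup → G.Adj a b ∨ G.Adj a c ∨ G.Adj a d) :
    IsSixType G := by
  by_cases hxy : G.Adj x y
  · exact Or.inr (Or.inr (isSpannedBy_triangularPrism hV (a := x) (b := a) (c := y) (d := c)
      (e := z) (f := b) (by clear * - hn; grind only [List.nodup_cons, List.mem_cons,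
            List.not_mem_nil, List.nodup_nil]) hax.symm hay hxy hcz hbz.symm hbc.symm hcx.symm haz hby.symm))
  by_cases hyz : G.Adj y z
  · exact Or.inr (Or.inr (isSpannedBy_triangularPrism hV (a := b) (b := c) (c := x) (d := y)
      (e := z) (f := a) (by clear * - hn; grind only [List.nodup_cons, List.mem_cons,
            List.not_mem_nil, List.nodup_nil]) hbc hcx hbx hyz haz.symm hay.symm hby hcz hax.symm))
  · have hxz : G.Adj x z := by
      have := ht x y z (by clear * - hn; grind only [List.nodup_cons, List.mem_cons,
            List.not_mem_nil, List.nodup_nil])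
      tauto
    have hcy : G.Adj c y := by
      have := hd y c x z (by clear * - hn; grind only [List.nodup_cons, List.mem_cons,
            List.not_mem_nil, List.nodup_nil])
      rw [G.adj_comm y c, G.adj_comm y x] at this
      tauto
    exact Or.inr (Or.inr (isSpannedBy_triangularPrism hV (a := b) (b := c) (c := y) (d := x)
      (e := z) (f := a) (by clear * - hn; grind only [List.nodup_cons, List.mem_cons,
            List.not_mem_nil, List.nodup_nil]) hbc hcy hby hxz haz.symm hax.symm hbx hcz hay.symm))

/-- Between {b, c} and {x, y, z} only `bx` and `cy` may be missing. If these and `xy` are all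
absent, the degree bound makes `z` adjacent to `x` and `y`, hence the apex over the pentagon `a x c
b y`; any of the three edges leads to a prism. -/
lemma isSixType_of_labelling (hV : Fintype.card V = 6)
    (hd : ∀ a b c d, [a, b, c, d].Nodup → G.Adj a b ∨ G.Adj a c ∨ G.Adj a d)
    (ht : ∀ a b c, [a, b, c].Nodup → G.Adj a b ∨ G.Adj b c ∨ G.Adj a c)
    {a b c x y z : V} (hn : [a, b, c, x, y, z].Nodup) (hax : G.Adj a x) (hay : G.Adj a y)
    (haz : G.Adj a z) (hbc : G.Adj b c) (hby : G.Adj b y) (hbz : G.Adj b z) (hcx : G.Adj c x)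
    (hcz : G.Adj c z) : IsSixType G := by
  by_cases hxy : G.Adj x y
  · exact Or.inr (Or.inr (isSpannedBy_triangularPrism hV (a := x) (b := a) (c := y) (d := c)
      (e := z) (f := b) (by clear * - hn; grind only [List.nodup_cons, List.mem_cons,
            List.not_mem_nil, List.nodup_nil]) hax.symm hay hxy hcz hbz.symm hbc.symm hcx.symm haz hby.symm))
  by_cases hbx : G.Adj b x
  · exact isSixType_of_labelling_of_adj hV ht hn hax hay haz hbc hby hbz hcx hcz hbx hd
  by_cases hcy : G.Adj c y
  · exact isSixType_of_labelling_of_adj hV ht (a := a) (b := c) (c := b) (x := y) (y := x) (z := z)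
      (by clear * - hn; grind only [List.nodup_cons, List.mem_cons,
            List.not_mem_nil, List.nodup_nil]) hay hax haz hbc.symm hcx hcz hby hbz hcy hd
  have hxz : G.Adj x z := by
    have := hd x b y z (by clear * - hn; grind only [List.nodup_cons, List.mem_cons,
            List.not_mem_nil, List.nodup_nil])
    rw [G.adj_comm x b] at this
    tauto
  have hyz : G.Adj y z := by
    have := hd y c x z (by clear * - hn; grind only [List.nodup_cons, List.mem_cons,
            List.not_mem_nil, List.nodup_nil])
    rw [G.adj_comm y c, G.adj_comm y x] at this
    tauto
  exact Or.inl (isSpannedBy_coneOnPentagon hV (a := a) (b := x) (c := c) (d := b) (e := y)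
    (f := z) (by clear * - hn; grind only [List.nodup_cons, List.mem_cons,
            List.not_mem_nil, List.nodup_nil]) hax hcx.symm hbc.symm hby hay.symm haz.symm hxz.symm hcz.symm hbz.symm
    hyz.symm)

/-- The exceptional non-neighbours of `b` and `c` coincide. -/
lemma isSixType_of_labelling_of_common (hV : Fintype.card V = 6)
    (hd : ∀ a b c d, [a, b, c, d].Nodup → G.Adj a b ∨ G.Adj a c ∨ G.Adj a d)
    (ht : ∀ a b c, [a, b, c].Nodup → G.Adj a b ∨ G.Adj b c ∨ G.Adj a c)
    {a b c x y z : V} (hn : [a, b, c, x, y, z].Nodup) (hax : G.Adj a x) (hay : G.Adj a y)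
    (haz : G.Adj a z) (hbc : G.Adj b c) (hby : G.Adj b y) (hbz : G.Adj b z) (hcy : G.Adj c y)
    (hcz : G.Adj c z) : IsSixType G := by
  by_cases hbx : G.Adj b x
  · exact isSixType_of_labelling hV hd ht (a := a) (b := b) (c := c) (x := y) (y := x) (z := z)
      (by clear * - hn; grind only [List.nodup_cons, List.mem_cons,
            List.not_mem_nil, List.nodup_nil]) hay hax haz hbc hbx hbz hcy hcz
  by_cases hcx : G.Adj c x
  · exact isSixType_of_labelling hV hd ht (a := a) (b := b) (c := c) (x := x) (y := y) (z := z)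
      (by clear * - hn; grind only [List.nodup_cons, List.mem_cons,
            List.not_mem_nil, List.nodup_nil]) hax hay haz hbc hby hbz hcx hcz
  have hxy : G.Adj x y := by
    have := hd x b c y (by clear * - hn; grind only [List.nodup_cons, List.mem_cons,
            List.not_mem_nil, List.nodup_nil])
    rw [G.adj_comm x b, G.adj_comm x c] at this
    tauto
  have hxz : G.Adj x z := by
    have := hd x b c z (by clear * - hn; grind only [List.nodup_cons, List.mem_cons,
            List.not_mem_nil, List.nodup_nil])
    rw [G.adj_comm x b, G.adj_comm x c] at this
    tauto
  -- Both `y` and `z` are joined to the ends of the two disjoint edges `ax` and `bc`.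
  exact Or.inr (Or.inl (isSpannedBy_fourTriangles hV (a := y) (b := z) (c := a) (d := x) (e := b)
    (f := c) (by clear * - hn; grind only [List.nodup_cons, List.mem_cons,
            List.not_mem_nil, List.nodup_nil]) hax hbc hay.symm hxy.symm hby.symm hcy.symm haz.symm hxz.symm hbz.symm
    hcz.symm))

set_option maxHeartbeats 1000000 in
/-- A graph of order six whose complement is triangle-free with maximum degree at most two. -/
lemma isSixType_of_card_six (hV : Fintype.card V = 6)
    (hd : ∀ a b c d, [a, b, c, d].Nodup → G.Adj a b ∨ G.Adj a c ∨ G.Adj a d)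
    (ht : ∀ a b c, [a, b, c].Nodup → G.Adj a b ∨ G.Adj b c ∨ G.Adj a c) : IsSixType G := by
  obtain ⟨a, b, c, hn3, hbc, ha, hbc'⟩ := exists_labelling (by omega) hd ht
  obtain ⟨d, hd'⟩ := exists_notMem_list [a, b, c] (by simp; omega)
  obtain ⟨e, he'⟩ := exists_notMem_list [a, b, c, d] (by simp; omega)
  obtain ⟨f, hf'⟩ := exists_notMem_list [a, b, c, d, e] (by simp; omega)
  have hn : [a, b, c, d, e, f].Nodup := by
    clear * - hn3 hd' he' hf'
    simp only [List.nodup_cons, List.mem_cons, List.not_mem_nil, or_false, not_or] at *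
    grind
  have had := ha d hd'
  have hae := ha e (by
      clear * - hn
      simp only [List.nodup_cons, List.mem_cons, List.not_mem_nil, or_false, not_or] at *
      grind)
  have haf := ha f (by
      clear * - hn
      simp only [List.nodup_cons, List.mem_cons, List.not_mem_nil, or_false, not_or] at *
      grind)
  obtain ⟨hb1, hc1⟩ := hbc' d e (by
      clear * - hn
      simp only [List.nodup_cons, List.mem_cons, List.not_mem_nil, or_false, not_or] at *
      grind)
  obtain ⟨hb2, hc2⟩ := hbc' d f (by
      clear * - hn
      simp only [List.nodup_cons, List.mem_cons, List.not_mem_nil, or_false, not_or] at *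
      grind)
  obtain ⟨hb3, hc3⟩ := hbc' e f (by
      clear * - hn
      simp only [List.nodup_cons, List.mem_cons, List.not_mem_nil, or_false, not_or] at *
      grind)
  -- Each of `b`, `c` misses at most one of `d`, `e`, `f`; the nine cases record these exceptions,
  -- which coincide or differ.
  have hb : (G.Adj b e ∧ G.Adj b f) ∨ (G.Adj b d ∧ G.Adj b f) ∨ (G.Adj b d ∧ G.Adj b e) := by
    tauto
  have hc : (G.Adj c e ∧ G.Adj c f) ∨ (G.Adj c d ∧ G.Adj c f) ∨ (G.Adj c d ∧ G.Adj c e) := by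
    tauto
  rcases hb with ⟨hb, hb'⟩ | ⟨hb, hb'⟩ | ⟨hb, hb'⟩ <;>
    rcases hc with ⟨hc, hc'⟩ | ⟨hc, hc'⟩ | ⟨hc, hc'⟩
  · exact isSixType_of_labelling_of_common hV hd ht (x := d) (y := e) (z := f) (by
      clear * - hn
      simp only [List.nodup_cons, List.mem_cons, List.not_mem_nil, or_false, not_or] at *
      grind) had hae haf hbc hb hb' hc hc'
  · exact isSixType_of_labelling hV hd ht (x := d) (y := e) (z := f) (by
      clear * - hn
      simp only [List.nodup_cons, List.mem_cons, List.not_mem_nil, or_false, not_or] at *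
      grind) had hae haf hbc hb hb' hc hc'
  · exact isSixType_of_labelling hV hd ht (x := d) (y := f) (z := e) (by
      clear * - hn
      simp only [List.nodup_cons, List.mem_cons, List.not_mem_nil, or_false, not_or] at *
      grind) had haf hae hbc hb' hb hc hc'
  · exact isSixType_of_labelling hV hd ht (x := e) (y := d) (z := f) (by
      clear * - hn
      simp only [List.nodup_cons, List.mem_cons, List.not_mem_nil, or_false, not_or] at *
      grind) hae had haf hbc hb hb' hc hc'
  · exact isSixType_of_labelling_of_common hV hd ht (x := e) (y := d) (z := f) (by
      clear * - hn
      simp only [List.nodup_cons, List.mem_cons, List.not_mem_nil, or_false, not_or] at *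
      grind) hae had haf hbc hb hb' hc hc'
  · exact isSixType_of_labelling hV hd ht (x := e) (y := f) (z := d) (by
      clear * - hn
      simp only [List.nodup_cons, List.mem_cons, List.not_mem_nil, or_false, not_or] at *
      grind) hae haf had hbc hb' hb hc' hc
  · exact isSixType_of_labelling hV hd ht (x := f) (y := d) (z := e) (by
      clear * - hn
      simp only [List.nodup_cons, List.mem_cons, List.not_mem_nil, or_false, not_or] at *
      grind) haf had hae hbc hb hb' hc' hc
  · exact isSixType_of_labelling hV hd ht (x := f) (y := e) (z := d) (by
      clear * - hn
      simp only [List.nodup_cons, List.mem_cons, List.not_mem_nil, or_false, not_or] at *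
      grind) haf hae had hbc hb' hb hc' hc
  · exact isSixType_of_labelling_of_common hV hd ht (x := f) (y := d) (z := e) (by
      clear * - hn
      simp only [List.nodup_cons, List.mem_cons, List.not_mem_nil, or_false, not_or] at *
      grind) haf had hae hbc hb hb' hc hc'

end Dense

/-! ### Necessity, according to the order of the graph -/

section Assembly

variable {V : Type*} [Fintype V] {G : SimpleGraph V}

lemma card_add_card_moved_le {i : V} {L : Finset V} {f : V → V} (hi : f i = i)
    (hL : ∀ x ∈ L, G.Adj i x ∧ f x = x) : L.card + (moved f).card + 1 ≤ Fintype.card V := by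
  classical
  have hiL : i ∉ L := fun h => (hL i h).1.ne rfl
  have hdisj : Disjoint (insert i L) (moved f) := by
    rw [Finset.disjoint_left]
    intro x hx
    rw [mem_moved, not_not]
    rcases Finset.mem_insert.1 hx with rfl | hx
    · exact hi
    · exact (hL x hx).2
  have h := (insert i L ∪ moved f).card_le_univ
  rw [Finset.card_union_of_disjoint hdisj, Finset.card_insert_of_notMem hiL] at h
  omega

/-- Since `i`, `L` and the moved vertices are disjoint, 8 ≤ 2|L| + |moved f| ≤ 2(|V| - 1). -/
lemma HasConfig.five_le_card {i : V} (h : HasConfig G i) : 5 ≤ Fintype.card V := by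
  classical
  obtain ⟨L, f, hf, hi, hL, hc⟩ := h
  have := card_add_card_moved_le hi hL
  omega

lemma HasConfig.adj_of_card_eq_five {i : V} (h : HasConfig G i) (hV : Fintype.card V = 5) {j : V}
    (hij : i ≠ j) : G.Adj i j := by
  classical
  obtain ⟨L, f, hf, hi, hL, hc⟩ := h
  have h1 := card_add_card_moved_le hi hL
  have hiL : i ∉ L := fun h => (hL i h).1.ne rfl
  by_contra hj
  have hjL : j ∉ insert i L := by
    rw [Finset.mem_insert]
    rintro (h | h)
    · exact hij h.symm
    · exact hj (hL j h).1
  have h2 := (insert j (insert i L)).card_le_univ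
  rw [Finset.card_insert_of_notMem hjL, Finset.card_insert_of_notMem hiL] at h2
  omega

lemma nonempty_iso_K {W : Type*} [Fintype W] {X : SimpleGraph W} {n : ℕ}
    (hW : Fintype.card W = n) (h : ∀ x y, x ≠ y → X.Adj x y) : Nonempty (X ≃g K n) := by
  refine ⟨⟨Fintype.equivFinOfCardEq hW, fun {a b} => ?_⟩⟩
  rw [top_adj]
  exact ⟨fun hne => h a b fun hab => hne (hab ▸ rfl), fun hab h' => hab.ne
    ((Fintype.equivFinOfCardEq hW).injective h')⟩

open Classical in
/-- Inside a closed set `E`, a graph with configurations is dense when `E` is small. -/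
lemma adj_of_hasConfig (E : Finset V) (s : ℕ) (hE : ∀ x ∈ E, ∀ y, G.Adj x y → y ∈ E)
    (hs : ∀ f, IsMatchInv G f → ∃ T : Finset V, moved f ⊆ T ∪ E ∧ T.card ≤ s)
    (he : 2 * E.card + s ≤ 12) (hc : ∀ i, HasConfig G i) :
    (∀ a ∈ E, ∀ b ∈ E, ∀ c ∈ E, ∀ d ∈ E, [a, b, c, d].Nodup →
      G.Adj a b ∨ G.Adj a c ∨ G.Adj a d) ∧
    (∀ a ∈ E, ∀ b ∈ E, ∀ c ∈ E, [a, b, c].Nodup → G.Adj a b ∨ G.Adj b c ∨ G.Adj a c) := by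
  classical
  -- At most `s` moved vertices lie outside `E`, and none lie in `L ∪ M`. With |M| + |E \ L| ≥ 5
  -- this bounds 2|L| + |moved f| by 2|E| + s - 5 ≤ 7, contradicting a configuration.
  have hcount : ∀ (L M : Finset V) (f : V → V), IsMatchInv G f → L ⊆ E → M ⊆ E → Disjoint L M →
      (∀ x ∈ L ∪ M, f x = x) → (moved f).card + L.card + M.card ≤ s + E.card := by
    intro L M f hf hL hM hLM hfix
    obtain ⟨T, hT, hTs⟩ := hs f hf
    have h1 : moved f ⊆ T ∪ (E \ (L ∪ M)) := by
      intro x hx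
      rcases Finset.mem_union.1 (hT hx) with h | h
      · exact Finset.mem_union_left _ h
      · refine Finset.mem_union_right _ (Finset.mem_sdiff.2 ⟨h, fun h' => ?_⟩)
        exact mem_moved.1 hx (hfix x h')
    have h2 := (Finset.card_le_card h1).trans (Finset.card_union_le _ _)
    have h3 := Finset.union_subset hL hM
    have h4 := Finset.card_le_card h3
    rw [Finset.card_sdiff_of_subset h3] at h2
    rw [Finset.card_union_of_disjoint hLM] at h2 h4
    omega
  have hLcard : ∀ (L M : Finset V), L ⊆ E → M ⊆ E → Disjoint L M → L.card + M.card ≤ E.card := by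
    intro L M hL hM hLM
    rw [← Finset.card_union_of_disjoint hLM]
    exact Finset.card_le_card (Finset.union_subset hL hM)
  constructor
  · intro a ha b hb c hcE d hd hn
    by_contra! hno
    obtain ⟨L, f, hf, hfa, hL, hcard⟩ := hc a
    have hLE : L ⊆ E := fun x hx => hE a ha x (hL x hx).1
    have h1 := hcount L {a} f hf hLE (by simpa using ha)
      (by rw [Finset.disjoint_singleton_right]; exact fun h => (hL a h).1.ne rfl)
      (by
        intro x hx
        rcases Finset.mem_union.1 hx with h | h
        · exact (hL x h).2
        · rw [Finset.mem_singleton.1 h]; exact hfa)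
    have h2 := hLcard L [a, b, c, d].toFinset hLE
      (by intro x; simp only [List.mem_toFinset, List.mem_cons, List.not_mem_nil, or_false]
          rintro (rfl | rfl | rfl | rfl) <;> assumption)
      (by
        rw [Finset.disjoint_left]
        intro x hx
        have := (hL x hx).1
        simp only [List.mem_toFinset, List.mem_cons, List.not_mem_nil, or_false]
        rintro (rfl | rfl | rfl | rfl)
        · exact this.ne rfl
        · exact hno.1 this
        · exact hno.2.1 this
        · exact hno.2.2 this)
    rw [List.toFinset_card_of_nodup hn] at h2
    simp only [Finset.card_singleton, List.length_cons, List.length_nil] at h1 h2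
    omega
  · intro a ha b hb c hcE hn
    by_contra! hno
    obtain ⟨L, f, hf, hfa, hL, hcard⟩ := hc a
    have hLE : L ⊆ E := fun x hx => hE a ha x (hL x hx).1
    have haL : a ∉ L := fun h => (hL a h).1.ne rfl
    have hbL : b ∉ L := fun h => hno.1 (hL b h).1
    have hcL : c ∉ L := fun h => hno.2.2 (hL c h).1
    have hab : a ≠ b := by grind
    -- If `b` is unmatched, it joins `a` in `M`; if it is matched, its partner is a fourth vertex of
    -- `E` outside `L`. Both ways the total is five.
    by_cases hfb : f b = b
    · have h1 := hcount L {a, b} f hf hLE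
        (by intro x; simp only [Finset.mem_insert, Finset.mem_singleton]
            rintro (rfl | rfl) <;> assumption)
        (by
          rw [Finset.disjoint_right]
          intro x; simp only [Finset.mem_insert, Finset.mem_singleton]
          rintro (rfl | rfl) <;> assumption)
        (by
          intro x hx
          simp only [Finset.mem_union, Finset.mem_insert, Finset.mem_singleton] at hx
          rcases hx with h | rfl | rfl
          · exact (hL x h).2
          · exact hfa
          · exact hfb)
      have h2 := hLcard L [a, b, c].toFinset hLE
        (by intro x; simp only [List.mem_toFinset, List.mem_cons, List.not_mem_nil, or_false]
            rintro (rfl | rfl | rfl) <;> assumption)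
        (by
          rw [Finset.disjoint_right]
          intro x; simp only [List.mem_toFinset, List.mem_cons, List.not_mem_nil, or_false]
          rintro (rfl | rfl | rfl) <;> assumption)
      rw [List.toFinset_card_of_nodup hn] at h2
      rw [Finset.card_pair hab] at h1
      simp only [List.length_cons, List.length_nil] at h2
      omega
    · have hadj := hf.2 b hfb
      have hfbE := hE b hb _ hadj
      have hfbL : f b ∉ L := fun h => hfb (by
        have := (hL _ h).2
        rwa [hf.1, eq_comm] at this)
      have hfba : f b ≠ a := fun h => hno.1 (h ▸ hadj).symm
      have hfbc : f b ≠ c := fun h => hno.2.1 (h ▸ hadj)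
      have hn' : [f b, a, b, c].Nodup := by
        rw [List.nodup_cons]
        exact ⟨by simp [hfba, hfb, hfbc], hn⟩
      have h1 := hcount L {a} f hf hLE (by simpa using ha)
        (by rwa [Finset.disjoint_singleton_right])
        (by
          intro x hx
          rcases Finset.mem_union.1 hx with h | h
          · exact (hL x h).2
          · rw [Finset.mem_singleton.1 h]; exact hfa)
      have h2 := hLcard L [f b, a, b, c].toFinset hLE
        (by intro x; simp only [List.mem_toFinset, List.mem_cons, List.not_mem_nil, or_false]
            rintro (rfl | rfl | rfl | rfl) <;> assumption)
        (by
          rw [Finset.disjoint_right]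
          intro x; simp only [List.mem_toFinset, List.mem_cons, List.not_mem_nil, or_false]
          rintro (rfl | rfl | rfl | rfl) <;> assumption)
      rw [List.toFinset_card_of_nodup hn'] at h2
      simp only [Finset.card_singleton, List.length_cons, List.length_nil] at h1 h2
      omega

lemma isSixType_of_hasConfig (hV : Fintype.card V = 6) (hc : ∀ i, HasConfig G i) :
    IsSixType G := by
  obtain ⟨h1, h2⟩ := adj_of_hasConfig (G := G) Finset.univ 0 (fun _ _ _ _ => Finset.mem_univ _)
    (fun f _ => ⟨∅, by simp, by simp⟩) (by rw [Finset.card_univ, hV]) hc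
  exact isSixType_of_card_six hV
    (fun a b c d => h1 a (Finset.mem_univ _) b (Finset.mem_univ _) c (Finset.mem_univ _) d
      (Finset.mem_univ _))
    (fun a b c => h2 a (Finset.mem_univ _) b (Finset.mem_univ _) c (Finset.mem_univ _))

lemma card_notMem [DecidableEq V] (D : Finset V) :
    Fintype.card {x | x ∉ D} + D.card = Fintype.card V := by
  have h : Fintype.card {x | x ∉ D} = (Dᶜ).card := by
    rw [Fintype.card_subtype]
    congr 1
    ext x
    simp
  rw [h, add_comm, Finset.card_add_card_compl]

/-- Splitting off a closed clique. -/
lemma nonempty_iso_K_sum {D : Finset V} {k : ℕ} (hk : D.card = k)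
    (hclosed : ∀ x ∈ D, ∀ y, G.Adj x y → y ∈ D)
    (hclique : ∀ x ∈ D, ∀ y ∈ D, x ≠ y → G.Adj x y) :
    Nonempty (G ≃g K k ⊕g G.induce {x | x ∉ D}) := by
  classical
  obtain ⟨e⟩ := nonempty_iso_K (X := G.induce {x | x ∈ D}) (n := k) (by simpa using hk)
    fun x y hxy => hclique x x.2 y y.2 fun h => hxy (Subtype.ext h)
  have e' : G.induce {x | x ∈ D} ⊕g G.induce {x | x ∉ D} ≃g G := by
    refine ⟨Equiv.sumCompl fun x => x ∈ D, ?_⟩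
    rintro (x | x) (y | y)
    · exact Iff.rfl
    · refine ⟨fun h => absurd (hclosed _ x.2 _ h) y.2, fun h => ?_⟩
      simp at h
    · refine ⟨fun h => absurd (hclosed _ y.2 _ h.symm) x.2, fun h => ?_⟩
      simp at h
    · exact Iff.rfl
  exact ⟨e'.symm.trans (Iso.sumCongr e Iso.refl)⟩

open Classical in
/-- A three-element set of minimum inner degree two is a triangle. -/
lemma adj_of_card_three {D : Finset V} (hD : D.card = 3)
    (hdeg : ∀ x ∈ D, 2 ≤ (D.filter (G.Adj x)).card) : ∀ x ∈ D, ∀ y ∈ D, x ≠ y → G.Adj x y := by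
  intro x hx y hy hxy
  have h1 : D.filter (G.Adj x) ⊆ D.erase x := by
    intro z hz
    rw [Finset.mem_filter] at hz
    exact Finset.mem_erase.2 ⟨hz.2.ne.symm, hz.1⟩
  have h2 := Finset.eq_of_subset_of_card_le h1 (by
    rw [Finset.card_erase_of_mem hx, hD]
    exact hdeg x hx)
  have h3 : y ∈ D.filter (G.Adj x) := h2 ▸ Finset.mem_erase.2 ⟨hxy.symm, hy⟩
  exact (Finset.mem_filter.1 h3).2

lemma exists_labelling_of_card_three {D : Finset V} (hD : D.card = 3) {c : V} (hc : c ∈ D) :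
    ∃ a b, [a, b, c].Nodup ∧ a ∈ D ∧ b ∈ D := by
  classical
  have h : (D.erase c).card = 2 := by rw [Finset.card_erase_of_mem hc, hD]
  obtain ⟨a, b, hab, hD'⟩ := Finset.card_eq_two.1 h
  have ha : a ∈ D.erase c := by rw [hD']; simp
  have hb : b ∈ D.erase c := by rw [hD']; simp
  rw [Finset.mem_erase] at ha hb
  refine ⟨a, b, ?_, ha.2, hb.2⟩
  simp [hab, ha.1, hb.1]

-- Counting at a vertex of `D` with `D` removed from the family gives 9 + (|P| - 1) ≤ d + |V| + |A|
-- ≤ d + |P| + 6 for the inner degree d.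
open Classical in
lemma IsBarrier.two_le_card_filter {A : Finset V} {P : Finset (Finset V)} (hP : IsBarrier G A P)
    (hc : ∀ i, HasConfig G i) (hdef : A.card + Fintype.card V ≤ P.card + 6) :
    ∀ D ∈ P, ∀ x ∈ D, 2 ≤ (D.filter (G.Adj x)).card := by
  intro D hD x hx
  have hP' : IsBarrier G A (P.erase D) :=
    ⟨fun E hE => hP.closed E (Finset.mem_of_mem_erase hE),
      fun E hE => hP.odd E (Finset.mem_of_mem_erase hE),
      fun E hE E' hE' => hP.disj E (Finset.mem_of_mem_erase hE) E' (Finset.mem_of_mem_erase hE')⟩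
  have h := (hc x).card_neighbors_ge hP' (hP.closed D hD)
    (fun E hE => hP.disj D hD E (Finset.mem_of_mem_erase hE) (Finset.ne_of_mem_erase hE).symm) hx
  rw [Finset.card_erase_of_mem hD] at h
  omega

lemma IsBarrier.three_le_card {A : Finset V} {P : Finset (Finset V)} (hP : IsBarrier G A P)
    (hc : ∀ i, HasConfig G i) (hdef : A.card + Fintype.card V ≤ P.card + 6) :
    ∀ D ∈ P, 3 ≤ D.card := by
  classical
  intro D hD
  obtain ⟨x, hx⟩ := Finset.card_pos.1 (hP.odd D hD).pos
  have h := hP.two_le_card_filter hc hdef D hD x hx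
  have h1 : D.filter (G.Adj x) ⊆ D.erase x := by
    intro z hz
    rw [Finset.mem_filter] at hz
    exact Finset.mem_erase.2 ⟨hz.2.ne.symm, hz.1⟩
  have h2 := Finset.card_le_card h1
  rw [Finset.card_erase_of_mem hx] at h2
  omega

lemma IsBarrier.sum_card_add_le {A : Finset V} {P : Finset (Finset V)} (hP : IsBarrier G A P) :
    ∑ D ∈ P, D.card + A.card ≤ Fintype.card V := by
  classical
  obtain ⟨h1, h2⟩ := hP.card_add_sum_le
  rw [← h1, ← Finset.card_union_of_disjoint h2]
  exact Finset.card_le_univ _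

lemma IsBarrier.three_mul_card_le {A : Finset V} {P : Finset (Finset V)} (hP : IsBarrier G A P)
    (hc : ∀ i, HasConfig G i) (hdef : A.card + Fintype.card V ≤ P.card + 6) :
    3 * P.card ≤ ∑ D ∈ P, D.card := by
  have := Finset.card_nsmul_le_sum P (fun D => D.card) 3 (hP.three_le_card hc hdef)
  rw [smul_eq_mul] at this
  omega

/-- The triangle `D` is a component, and the remaining four vertices form a clique. -/
lemma nonempty_iso_of_not_adj {v : V} {D E : Finset V} (hV : Fintype.card V = 7)
    (hc : ∀ i, HasConfig G i) (hD : D.card = 3) (hE : E.card = 3) (hDE : Disjoint D E)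
    (hvD : v ∉ D) (hvE : v ∉ E) (hclD : IsClosedMod G {v} D)
    (hD' : ∀ x ∈ D, ∀ y ∈ D, x ≠ y → G.Adj x y) (hE' : ∀ x ∈ E, ∀ y ∈ E, x ≠ y → G.Adj x y)
    (hno : ∀ x ∈ D, ¬ G.Adj v x) : Nonempty (G ≃g K 3 ⊕g K 4) := by
  classical
  have hclosed : ∀ x ∈ D, ∀ y, G.Adj x y → y ∈ D := by
    intro x hx y hxy
    rcases hclD.2 x hx y hxy with h | h
    · exact h
    · rw [Finset.mem_singleton] at h
      subst h
      exact absurd hxy.symm (hno x hx)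
  have hcompl : Dᶜ = insert v E := by
    refine (Finset.eq_of_subset_of_card_le ?_ ?_).symm
    · intro x hx
      rw [Finset.mem_compl]
      rcases Finset.mem_insert.1 hx with rfl | hx
      · exact hvD
      · exact Finset.disjoint_right.1 hDE hx
    · rw [Finset.card_insert_of_notMem hvE, Finset.card_compl]
      omega
  have hP : IsBarrier G ∅ {D} := by
    refine ⟨?_, ?_, ?_⟩
    · intro D' h
      rw [Finset.mem_singleton.1 h]
      exact ⟨Finset.disjoint_empty_right _, fun x hx y hxy => Or.inl (hclosed x hx y hxy)⟩
    · intro D' h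
      rw [Finset.mem_singleton.1 h, hD]
      decide
    · intro D' h D'' h' hne
      rw [Finset.mem_singleton] at h h'
      exact absurd (h.trans h'.symm) hne
  -- With empty `A` and the single block `D`, the count gives `v` at least 9 + 1 - 7 = 3 neighbours
  -- outside `D`, that is, all of `E`.
  have hcount := (hc v).card_neighbors_ge hP (E := Dᶜ)
    ⟨Finset.disjoint_empty_right _, fun x hx y hxy => by
      rw [Finset.mem_compl] at hx ⊢
      exact Or.inl fun hy => hx (hclosed y hy x hxy.symm)⟩
    (fun D' h => by rw [Finset.mem_singleton.1 h]; exact disjoint_compl_left)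
    (by simpa using hvD)
  rw [Finset.card_singleton, Finset.card_empty, hV] at hcount
  have hsub : (Dᶜ).filter (G.Adj v) ⊆ E := by
    intro x hx
    rw [hcompl, Finset.mem_filter, Finset.mem_insert] at hx
    rcases hx with ⟨rfl | hx, h⟩
    · exact absurd rfl h.ne
    · exact hx
  have heq := Finset.eq_of_subset_of_card_le hsub (by omega)
  have hvadj : ∀ x ∈ E, G.Adj v x := by
    intro x hx
    rw [← heq] at hx
    exact (Finset.mem_filter.1 hx).2
  obtain ⟨e⟩ := nonempty_iso_K_sum hD hclosed hD'
  have hmem : ∀ x : {x | x ∉ D}, x.1 = v ∨ x.1 ∈ E := by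
    intro x
    have h : x.1 ∈ Dᶜ := Finset.mem_compl.2 x.2
    rwa [hcompl, Finset.mem_insert] at h
  obtain ⟨e'⟩ := nonempty_iso_K (X := G.induce {x | x ∉ D}) (n := 4)
    (by have := card_notMem D; omega) (by
      intro x y hxy
      have hne : x.1 ≠ y.1 := fun h => hxy (Subtype.ext h)
      rw [comap_adj]
      change G.Adj x.1 y.1
      rcases hmem x with hx | hx <;> rcases hmem y with hy | hy
      · exact absurd (hx.trans hy.symm) hne
      · rw [hx]; exact hvadj _ hy
      · rw [hy]; exact (hvadj _ hx).symm
      · exact hE' _ hx _ hy hne)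
  exact ⟨e.trans (Iso.sumCongr Iso.refl e')⟩

/-- Order seven: the graph is factor-critical, or consists of two triangles and one more vertex. -/
lemma isSevenType_or_iso (hV : Fintype.card V = 7) (hc : ∀ i, HasConfig G i) :
    IsSevenType G ∨ Nonempty (G ≃g K 3 ⊕g K 4) := by
  classical
  by_cases hG : IsFactorCritical G
  · exact Or.inl (hG.isSevenType hV)
  unfold IsFactorCritical at hG
  push Not at hG
  obtain ⟨v, hv⟩ := hG
  rcases exists_nearPerfect_or_isBarrier G (by rw [hV]; decide) v with ⟨f, hf, hfv, hmove⟩ | h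
  · obtain ⟨x, hx, hfx⟩ := hv f hf hfv
    exact absurd hfx (hmove x hx)
  obtain ⟨A, P, hP, hvA, hAP⟩ := h
  have hdef : A.card + Fintype.card V ≤ P.card + 6 := by omega
  have hdeg := hP.two_le_card_filter hc hdef
  have h3 := hP.three_le_card hc hdef
  have hsum := hP.sum_card_add_le
  have hmul := hP.three_mul_card_le hc hdef
  have hApos : 0 < A.card := Finset.card_pos.2 ⟨v, hvA⟩
  -- Blocks of size at least three give |A| + |P| ≤ 3, while |P| ≥ |A| + 1 and `A` is nonempty.
  obtain ⟨v', hA⟩ := Finset.card_eq_one.1 (show A.card = 1 by omega)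
  obtain rfl : v = v' := by simpa [hA] using hvA
  obtain ⟨D, E, hDE, rfl⟩ := Finset.card_eq_two.1 (show P.card = 2 by omega)
  rw [Finset.sum_pair hDE] at hsum
  have hDP : D ∈ ({D, E} : Finset (Finset V)) := by simp
  have hEP : E ∈ ({D, E} : Finset (Finset V)) := by simp
  have hD3 := h3 D hDP
  have hE3 := h3 E hEP
  have hD : D.card = 3 := by omega
  have hE : E.card = 3 := by omega
  have hclD := hP.closed D hDP
  have hclE := hP.closed E hEP
  rw [hA] at hclD hclE
  have hvD : v ∉ D := by simpa using hclD.1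
  have hvE : v ∉ E := by simpa using hclE.1
  have hdisj := hP.disj D hDP E hEP hDE
  have hD' := adj_of_card_three hD (hdeg D hDP)
  have hE' := adj_of_card_three hE (hdeg E hEP)
  by_cases hvd : ∃ x ∈ D, G.Adj v x
  · by_cases hve : ∃ x ∈ E, G.Adj v x
    · left
      obtain ⟨c, hcD, hvc⟩ := hvd
      obtain ⟨d, hdE, hvd⟩ := hve
      obtain ⟨a, b, hn, ha, hb⟩ := exists_labelling_of_card_three hD hcD
      obtain ⟨e, f, hn', he, hf⟩ := exists_labelling_of_card_three hE hdE
      have hne : ∀ x ∈ D, ∀ y ∈ E, x ≠ y := fun x hx y hy h =>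
        Finset.disjoint_left.1 hdisj hx (h ▸ hy)
      have hne1 : ∀ x ∈ D, x ≠ v := fun x hx h => hvD (h ▸ hx)
      have hne2 : ∀ x ∈ E, v ≠ x := fun x hx h => hvE (h ▸ hx)
      simp only [List.nodup_cons, List.mem_cons, List.not_mem_nil, or_false, not_or,
        not_false_eq_true, List.nodup_nil, and_true] at hn hn'
      refine Or.inr (Or.inr (Or.inr (Or.inr (isSpannedBy_trianglesWithPath hV (a := a) (b := b)
        (c := c) (d := v) (e := d) (f := e) (g := f) ?_ (hD' a ha b hb hn.1.1)
        (hD' a ha c hcD hn.1.2) (hD' b hb c hcD hn.2) hvc.symm hvd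
        (hE' d hdE e he (Ne.symm hn'.1.2)) (hE' d hdE f hf (Ne.symm hn'.2))
        (hE' e he f hf hn'.1.1)))))
      simp only [List.nodup_cons, List.mem_cons, List.not_mem_nil, or_false, not_or,
        not_false_eq_true, List.nodup_nil, and_true]
      exact ⟨⟨hn.1.1, hn.1.2, hne1 a ha, hne a ha d hdE, hne a ha e he, hne a ha f hf⟩,
        ⟨hn.2, hne1 b hb, hne b hb d hdE, hne b hb e he, hne b hb f hf⟩,
        ⟨hne1 c hcD, hne c hcD d hdE, hne c hcD e he, hne c hcD f hf⟩,
        ⟨hne2 d hdE, hne2 e he, hne2 f hf⟩, ⟨Ne.symm hn'.1.2, Ne.symm hn'.2⟩, hn'.1.1⟩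
    · push Not at hve
      exact Or.inr (nonempty_iso_of_not_adj hV hc hE hD hdisj.symm hvE hvD hclE hE' hD' hve)
  · push Not at hvd
    exact Or.inr (nonempty_iso_of_not_adj hV hc hD hE hdisj hvD hvE hclD hD' hE' hvd)

/-- Order eight with a triangle component. -/
lemma exists_iso_of_triangle (hV : Fintype.card V = 8) (hc : ∀ i, HasConfig G i) {D : Finset V}
    (hD : D.card = 3) (hclosed : ∀ x ∈ D, ∀ y, G.Adj x y → y ∈ D)
    (hclique : ∀ x ∈ D, ∀ y ∈ D, x ≠ y → G.Adj x y) :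
    ∃ H : SimpleGraph (Fin 5), (IsSpannedBy H (cycleGraph 5) ∨ IsSpannedBy H bowtie) ∧
      Nonempty (G ≃g K 3 ⊕g H) := by
  classical
  -- A matching covers at most two vertices of the triangle, and 2 · 5 + 2 = 12.
  obtain ⟨h1, h2⟩ := adj_of_hasConfig (G := G) Dᶜ 2
    (fun x hx y hxy => by
      rw [Finset.mem_compl] at hx ⊢
      exact fun hy => hx (hclosed y hy x hxy.symm))
    (fun f hf => by
      obtain ⟨x, hx, hfx⟩ := exists_fixed_of_odd D f (fun x hx => by
        by_cases h : f x = x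
        · rwa [h]
        · exact hclosed x hx _ (hf.2 x h)) (fun x _ => hf.1 x) (by rw [hD]; decide)
      refine ⟨D.erase x, fun y hy => ?_, by rw [Finset.card_erase_of_mem hx, hD]⟩
      rw [Finset.mem_union, Finset.mem_erase, Finset.mem_compl]
      by_cases hyD : y ∈ D
      · exact Or.inl ⟨fun h => mem_moved.1 hy (h ▸ hfx), hyD⟩
      · exact Or.inr hyD)
    (by rw [Finset.card_compl]; omega) hc
  have hcard : Fintype.card {x | x ∉ D} = 5 := by
    have := card_notMem D
    omega
  have hm : ∀ x : {x | x ∉ D}, x.1 ∈ Dᶜ := fun x => Finset.mem_compl.2 x.2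
  have hspan := isSpannedBy_of_card_five (G := G.induce {x | x ∉ D}) hcard
    (fun a b c d hn => h1 a (hm a) b (hm b) c (hm c) d (hm d)
      (by simpa using hn.map Subtype.val_injective))
    (fun a b c hn => h2 a (hm a) b (hm b) c (hm c) (by simpa using hn.map Subtype.val_injective))
  obtain ⟨e⟩ := nonempty_iso_K_sum hD hclosed hclique
  let ε := Fintype.equivFinOfCardEq hcard
  let i : G.induce {x | x ∉ D} ≃g (G.induce {x | x ∉ D}).map ε.toEmbedding := Iso.map ε _
  have htrans : ∀ F : SimpleGraph (Fin 5), IsSpannedBy (G.induce {x | x ∉ D}) F →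
      IsSpannedBy ((G.induce {x | x ∉ D}).map ε.toEmbedding) F := by
    rintro F ⟨φ, hφ⟩
    exact ⟨i.toHom.comp φ, i.bijective.comp hφ⟩
  exact ⟨_, hspan.imp (htrans _) (htrans _), ⟨e.trans (Iso.sumCongr Iso.refl i)⟩⟩

lemma IsBarrier.closed_of_empty {P : Finset (Finset V)} (hP : IsBarrier G ∅ P) :
    ∀ D ∈ P, ∀ x ∈ D, ∀ y, G.Adj x y → y ∈ D := by
  intro D hD x hx y hxy
  simpa using (hP.closed D hD).2 x hx y hxy

lemma exists_iso_of_card_eight (hV : Fintype.card V = 8) (hc : ∀ i, HasConfig G i)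
    (hlt : ∀ f, IsMatchInv G f → (moved f).card < 8) :
    ∃ H : SimpleGraph (Fin 5), (IsSpannedBy H (cycleGraph 5) ∨ IsSpannedBy H bowtie) ∧
      Nonempty (G ≃g K 3 ⊕g H) := by
  classical
  obtain ⟨A, P, hP, hdef⟩ := exists_isBarrier_of_eight_le G hV.ge hlt
  have hdeg := hP.two_le_card_filter hc hdef
  have h3 := hP.three_le_card hc hdef
  have hsum := hP.sum_card_add_le
  have hmul := hP.three_mul_card_le hc hdef
  -- Here |P| ≥ |A| + 2 and |A| + |P| ≤ 3. Eight vertices have no room for three blocks, and two odd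
  -- blocks cannot both have five elements.
  obtain rfl : A = ∅ := Finset.card_eq_zero.1 (by omega)
  obtain ⟨D, E, hDE, hPDE⟩ := Finset.card_eq_two.1
    (show P.card = 2 by simp only [Finset.card_empty] at *; omega)
  rw [hPDE, Finset.sum_pair hDE, Finset.card_empty] at hsum
  have hDP : D ∈ P := by simp [hPDE]
  have hEP : E ∈ P := by simp [hPDE]
  have hD3 := h3 D hDP
  have hE3 := h3 E hEP
  have hDodd := Nat.odd_iff.1 (hP.odd D hDP)
  have hEodd := Nat.odd_iff.1 (hP.odd E hEP)
  have hdisj := hP.disj D hDP E hEP hDE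
  have h : D.card = 3 ∨ E.card = 3 := by omega
  rcases h with hD | hE
  · exact exists_iso_of_triangle hV hc hD (hP.closed_of_empty D hDP)
      (adj_of_card_three hD (hdeg D hDP))
  · exact exists_iso_of_triangle hV hc hE (hP.closed_of_empty E hEP)
      (adj_of_card_three hE (hdeg E hEP))

lemma nonempty_iso_of_card_nine (hV : 9 ≤ Fintype.card V) (hc : ∀ i, HasConfig G i)
    (hlt : ∀ f, IsMatchInv G f → (moved f).card < 8) :
    Nonempty (G ≃g K 3 ⊕g K 3 ⊕g K 3) := by
  classical
  obtain ⟨A, P, hP, hdef⟩ := exists_isBarrier_of_eight_le G (by omega) hlt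
  have hdeg := hP.two_le_card_filter hc hdef
  have h3 := hP.three_le_card hc hdef
  have hsum := hP.sum_card_add_le
  have hmul := hP.three_mul_card_le hc hdef
  -- Now |P| ≥ |A| + 3 and |A| + |P| ≤ 3, so there are exactly three blocks, and |V| ≤ |P| + 6 = 9
  -- makes them triangles covering everything.
  obtain rfl : A = ∅ := Finset.card_eq_zero.1 (by omega)
  obtain ⟨D, E, F, hDE, hDF, hEF, hPD⟩ := Finset.card_eq_three.1
    (show P.card = 3 by simp only [Finset.card_empty] at *; omega)
  have hDP : D ∈ P := by simp [hPD]
  have hEP : E ∈ P := by simp [hPD]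
  have hFP : F ∈ P := by simp [hPD]
  have hV' : Fintype.card V = 9 := by simp only [Finset.card_empty] at *; omega
  rw [hPD, Finset.sum_insert (by simp [hDE, hDF]), Finset.sum_pair hEF, Finset.card_empty] at hsum
  have hD3 := h3 D hDP
  have hE3 := h3 E hEP
  have hF3 := h3 F hFP
  have hD : D.card = 3 := by omega
  have hE : E.card = 3 := by omega
  have hF : F.card = 3 := by omega
  have hcl := hP.closed_of_empty
  have hclE := adj_of_card_three hE (hdeg E hEP)
  have hclF := adj_of_card_three hF (hdeg F hFP)
  obtain ⟨e⟩ := nonempty_iso_K_sum hD (hcl D hDP) (adj_of_card_three hD (hdeg D hDP))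
  have hcard := card_notMem D
  let ι : {x | x ∉ D} ↪ V := Function.Embedding.subtype _
  let E' : Finset {x | x ∉ D} := Finset.univ.filter fun x => x.1 ∈ E
  have hE' : E'.card = 3 := by
    rw [← hE, ← Finset.card_map ι]
    congr 1
    ext x
    simp only [Finset.mem_map, E', Finset.mem_filter, Finset.mem_univ, true_and]
    constructor
    · rintro ⟨y, hy, rfl⟩; exact hy
    · intro hx
      exact ⟨⟨x, Finset.disjoint_right.1 (hP.disj D hDP E hEP hDE) hx⟩, hx, rfl⟩
  have hmem : ∀ x : {x | x ∉ D}, x ∈ E' ↔ x.1 ∈ E := fun x => by simp [E']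
  obtain ⟨e'⟩ := nonempty_iso_K_sum (G := G.induce {x | x ∉ D}) hE'
    (fun x hx y hxy => (hmem y).2 (hcl E hEP _ ((hmem x).1 hx) _ hxy))
    (fun x hx y hy hxy => hclE _ ((hmem x).1 hx) _ ((hmem y).1 hy) fun h => hxy (Subtype.ext h))
  have hcard' := card_notMem E'
  have hunion : D ∪ E ∪ F = Finset.univ := by
    rw [← Finset.card_eq_iff_eq_univ, Finset.card_union_of_disjoint, Finset.card_union_of_disjoint
      (hP.disj D hDP E hEP hDE)]
    · omega
    · exact Finset.disjoint_union_left.2 ⟨hP.disj D hDP F hFP hDF, hP.disj E hEP F hFP hEF⟩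
  have hFmem : ∀ x : {x | x ∉ E'}, x.1.1 ∈ F := by
    intro x
    have h : x.1.1 ∈ D ∪ E ∪ F := hunion ▸ Finset.mem_univ _
    simp only [Finset.mem_union] at h
    rcases h with (h | h) | h
    · exact absurd h x.1.2
    · exact absurd ((hmem _).2 h) x.2
    · exact h
  obtain ⟨e''⟩ := nonempty_iso_K (X := (G.induce {x | x ∉ D}).induce {x | x ∉ E'}) (n := 3)
    (by omega) fun x y hxy => hclF _ (hFmem x) _ (hFmem y)
      fun h => hxy (Subtype.ext (Subtype.ext h))
  exact ⟨(e.trans (Iso.sumCongr Iso.refl (e'.trans (Iso.sumCongr Iso.refl e'')))).trans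
    Iso.sumAssoc.symm⟩

end Assembly

end EdgeIdealGraphs

theorem mainTheorem1 {V : Type*} [Fintype V] [Nonempty V] (G : SimpleGraph V)
    [DecidableRel G.Adj] :
    IsSaturating G 4 ↔
      (Nonempty (G ≃g K 5) ∨
       IsSpannedBy G coneOnPentagon ∨
       IsSpannedBy G fourTriangles ∨
       IsSpannedBy G triangularPrism ∨
       (∃ H : SimpleGraph (Fin 5),
          IsSpannedBy H (cycleGraph 5) ∧ Nonempty (G ≃g K 3 ⊕g H)) ∨
       (∃ H : SimpleGraph (Fin 5),
          IsSpannedBy H bowtie ∧ Nonempty (G ≃g K 3 ⊕g H)) ∨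
       Nonempty (G ≃g K 3 ⊕g K 4) ∨
       IsSpannedBy G (cycleGraph 7) ∨
       IsSpannedBy G trianglePentagon ∨
       IsSpannedBy G twoPentagons ∨
       IsSpannedBy G threeTriangles ∨
       IsSpannedBy G trianglesWithPath ∨
       Nonempty (G ≃g K 3 ⊕g K 3 ⊕g K 3)) := by
  constructor
  · intro hG
    obtain ⟨hlt, hc⟩ := IsSaturating.iff_matchInv.1 hG
    have h5 := (hc (Classical.arbitrary V)).five_le_card
    obtain h | h | h | h | h : Fintype.card V = 5 ∨ Fintype.card V = 6 ∨ Fintype.card V = 7 ∨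
        Fintype.card V = 8 ∨ 9 ≤ Fintype.card V := by omega
    · exact Or.inl (nonempty_iso_K h fun x y hxy => (hc x).adj_of_card_eq_five h hxy)
    · have := isSixType_of_hasConfig h hc
      unfold IsSixType at this
      tauto
    · have := isSevenType_or_iso h hc
      unfold IsSevenType at this
      tauto
    · obtain ⟨H, hH | hH, hiso⟩ := exists_iso_of_card_eight h hc hlt
      · exact Or.inr (Or.inr (Or.inr (Or.inr (Or.inl ⟨H, hH, hiso⟩))))
      · exact Or.inr (Or.inr (Or.inr (Or.inr (Or.inr (Or.inl ⟨H, hH, hiso⟩)))))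
    · have := nonempty_iso_of_card_nine h hc hlt
      tauto
  · rintro (h | h | h | h | ⟨H, hH, h⟩ | ⟨H, hH, h⟩ | h | h | h | h | h | h | h)
    · exact isSaturating_of_spanning (IsSpannedBy.of_iso h) (by simp) (by decide +kernel)
    · exact isSaturating_of_spanning h (by simp) (by decide +kernel)
    · exact isSaturating_of_spanning h (by simp) (by decide +kernel)
    · exact isSaturating_of_spanning h (by simp) (by decide +kernel)
    · exact isSaturating_of_triangle_sum hH h (by decide +kernel)
    · exact isSaturating_of_triangle_sum hH h (by decide +kernel)
    · exact isSaturating_of_spanning (IsSpannedBy.of_iso h) (by simp) (by decide +kernel)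
    · exact isSaturating_of_spanning h (by simp) (by decide +kernel)
    · exact isSaturating_of_spanning h (by simp) (by decide +kernel)
    · exact isSaturating_of_spanning h (by simp) (by decide +kernel)
    · exact isSaturating_of_spanning h (by simp) (by decide +kernel)
    · exact isSaturating_of_spanning h (by simp) (by decide +kernel)
    · exact isSaturating_of_three_triangle_sum h
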